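/- **Theorem (Improved Spectral Norm Bound for Kikuchi Matrix for Odd-$r$).** Let $r>2$ be odd. For $n\in\mathbb N$ let $G=(G_S)_{S\in\binom{[n]}{r}}$ be a random symmetric Gaussian tensor of order $r$, i.e. the entries $G_S$, indexed by the $r$-element subsets $S$ of $[n]$, are independent $N(0,1)$ random variables. For $\ell\in\mathbb N$ let $M_\ell(G)$ be the level-$\ell$ Kikuchi matrix of $G$: its rows and columns are indexed by the $\ell$-element subsets $S,T$ of $[n]$, and $$M_\ell(G)[S,T]=\sum_{t\in[n]\setminus(S\cup T)}\ \sum_{\substack{S_1\sqcup S_2=S\setminus T\\ |S_1|=|S_2|}}\ \sum_{\substack{T_1\sqcup T_2=T\setminus S\\ |T_1|=|T_2|}} G_{S_1\cup T_1\cup\{t\}}\cdot G_{S_2\cup T_2\cup\{t\}}\qquad\text{if } |S\,\Delta\, T|=2r-2,$$ and $M_\ell(G)[S,T]=0$ otherwise; the inner sums run over ordered pairs $(S_1,S_2)$ and $(T_1,T_2)$. Then there exist constants $\delta>0$ and $C>0$ depending only on $r$, and a sequence $\varepsilon_n\to 0$ depending only on $r$, such that for all $n,\ell\in\mathbb N$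 with $\ell\le n^\delta$, with probability at least $1-\varepsilon_n$, $$\|M_\ell(G)\|_{sp}\le C\cdot\left(\sqrt{n\ell}\right)^r,$$ where $\|\cdot\|_{sp}$ is the spectral norm (the operator norm on Euclidean space). -/

import Mathlib

open MeasureTheory ProbabilityTheory Filter Topology

namespace Kikuchi

/-- The `k`-element subsets of `[n]`. -/
abbrev Subsets (n k : ℕ) : Type := {S : Finset (Fin n) // S.card = k}

/-- A symmetric tensor of order `r` on `[n]`, given by its entries `G_S` for `r`-element sets `S`
(the entries with pairwise distinct indices, the only ones that enter a Kikuchi matrix). -/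
abbrev SymTensor (n r : ℕ) : Type := Subsets n r → ℝ

/-- The law of the random symmetric Gaussian tensor: the entries `G_S` are independent `N(0,1)`. -/
noncomputable def gaussianTensor (n r : ℕ) : Measure (SymTensor n r) :=
  Measure.pi fun _ : Subsets n r => gaussianReal 0 1

/-- The entry `G_A`. The value `0` for sets `A` with `A.card ≠ r` is a placeholder: by
`card_hyperedge` below such sets do not occur in the Kikuchi matrix of odd order. -/
noncomputable def SymTensor.entry {n r : ℕ} (G : SymTensor n r) (A : Finset (Fin n)) : ℝ :=
  if h : A.card = r then G ⟨A, h⟩ else 0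

/-- The ordered pairs `(A₁, A₂)` that partition `A` into two parts of equal size. -/
def equalPartitions {n : ℕ} (A : Finset (Fin n)) : Finset (Finset (Fin n) × Finset (Fin n)) :=
  (A.powerset ×ˢ A.powerset).filter fun p =>
    Disjoint p.1 p.2 ∧ p.1 ∪ p.2 = A ∧ p.1.card = p.2.card

/-- The level-`ℓ` Kikuchi matrix of a symmetric tensor of odd order `r`. The pairs `p` and `p'` are
the partitions `(S₁, S₂)` of `S \ T` and `(T₁, T₂)` of `T \ S`. -/
noncomputable def kikuchiMatrix {n r : ℕ} (ℓ : ℕ) (G : SymTensor n r) :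
    Matrix (Subsets n ℓ) (Subsets n ℓ) ℝ :=
  Matrix.of fun S T =>
    if (symmDiff S.1 T.1).card = 2 * r - 2 then
      ∑ t ∈ (S.1 ∪ T.1)ᶜ, ∑ p ∈ equalPartitions (S.1 \ T.1), ∑ p' ∈ equalPartitions (T.1 \ S.1),
        G.entry (p.1 ∪ p'.1 ∪ {t}) * G.entry (p.2 ∪ p'.2 ∪ {t})
    else 0

/-- The spectral norm of a real square matrix: its operator norm on Euclidean space. -/
noncomputable def spectralNorm {ι : Type*} [Fintype ι] [DecidableEq ι] (A : Matrix ι ι ℝ) : ℝ :=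
  ‖Matrix.toEuclideanCLM (𝕜 := ℝ) A‖

/-- For odd `r`, all sets at which a tensor is evaluated in `kikuchiMatrix` have size `r`. -/
theorem card_hyperedge {n r ℓ : ℕ} (hr : Odd r) (S T : Subsets n ℓ)
    (hST : (symmDiff S.1 T.1).card = 2 * r - 2) {t : Fin n} (ht : t ∈ (S.1 ∪ T.1)ᶜ)
    {p p' : Finset (Fin n) × Finset (Fin n)} (hp : p ∈ equalPartitions (S.1 \ T.1))
    (hp' : p' ∈ equalPartitions (T.1 \ S.1)) :
    (p.1 ∪ p'.1 ∪ {t}).card = r ∧ (p.2 ∪ p'.2 ∪ {t}).card = r := by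
  obtain ⟨k, rfl⟩ := hr
  simp only [equalPartitions, Finset.mem_filter, Finset.mem_product, Finset.mem_powerset] at hp hp'
  obtain ⟨⟨h1, h2⟩, hd, hu, hc⟩ := hp
  obtain ⟨⟨h1', h2'⟩, hd', hu', hc'⟩ := hp'
  have hcard := Finset.card_union_of_disjoint hd
  have hcard' := Finset.card_union_of_disjoint hd'
  rw [hu] at hcard
  rw [hu'] at hcard'
  have hdis : Disjoint (S.1 \ T.1) (T.1 \ S.1) := disjoint_sdiff_sdiff
  have hs : (S.1 \ T.1).card + (T.1 \ S.1).card = 2 * (2 * k + 1) - 2 := by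
    rw [← hST, ← Finset.card_union_of_disjoint hdis]; rfl
  have he : (S.1 \ T.1).card = (T.1 \ S.1).card :=
    Finset.card_sdiff_comm (S.2.trans T.2.symm)
  have key : ∀ A B : Finset (Fin n), A ⊆ S.1 \ T.1 → B ⊆ T.1 \ S.1 →
      (A ∪ B ∪ {t}).card = A.card + B.card + 1 := by
    intro A B hA hB
    rw [Finset.card_union_of_disjoint, Finset.card_union_of_disjoint, Finset.card_singleton]
    · exact Disjoint.mono hA hB hdis
    · rw [Finset.disjoint_singleton_right]
      intro h
      simp only [Finset.mem_compl, Finset.mem_union, not_or] at ht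
      rcases Finset.mem_union.1 h with h | h
      · exact ht.1 (Finset.mem_sdiff.1 (hA h)).1
      · exact ht.2 (Finset.mem_sdiff.1 (hB h)).1
  rw [key _ _ h1 h1', key _ _ h2 h2']
  omega

end Kikuchi

namespace Kikuchi

/-! ### Hermite polynomials and Gaussian integrals -/

/-! The proof is the trace moment method, with the Gaussian moments organised by Hermite
polynomials. Write `r = 2k+1`, `s = √(nℓ)`. Expand products of entries in the orthogonal family
`hermiteProd c`, where `c` counts hyperedges with multiplicity. By the three-term recurrence,
multiplication by an entry `G_e` either creates the hyperedge `e` or annihilates one of its `c e`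
copies. A factor of the Kikuchi matrix therefore acts on states `(S, c)`: a move replaces `S` by a
neighbour and creates or annihilates each of its two hyperedges. The expectation `E[(M^j)[S₀,S] ·
hermiteProd c]` obeys a recursion in `j` with nonnegative coefficients, after passing to absolute
values.

The recursion is controlled by a supersolution: with `w(S,c) = κ^(mass c) · u^|S ∪ vertices c|`, one
step multiplies `w` by at most `Λ = stepConst k · s^r` (`sum_moves_le`). The choice `κ² u^r s^r = ℓ`
balances the cases. Two creations cost `κ² ℓ^(2k) (2nu)^r`, which is of order `s^r`. One creation
and one annihilation cost at most a constant times `mass c · (nℓ)^k`, and `mass c ≤ s`.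

Two annihilations may lose `r` vertices, a factor `κ⁻² u⁻ʳ = s^r/ℓ`, so only `O(ℓ)` such moves are
affordable. If some lost vertex is still covered by another hyperedge, a factor `u` is saved and
beats the `O(mass²)` pairs. Otherwise the move is private: a vertex of `S₁ ⊆ S` determines the first
hyperedge and then `t` determines the second, which leaves at most `ℓ·r` moves
(`card_filter_isPrivate_le`). This count is what removes the logarithm from the bound.

Hence `E tr M^q ≤ C(n,ℓ) Λ^q`. With `q` of order `ℓ log n`, Markov's inequality at level `2Λ`
absorbs `C(n,ℓ)` into `2^q`. The conditions `u ≈ q⁻²` and `nu ≳ q` amount to `q³ ≲ n`, which holds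
when `ℓ ≤ n^(1/4)` and `n` is large. -/

open Polynomial in
theorem derivative_hermite_succ (m : ℕ) :
    derivative (hermite (m + 1)) = ((m : ℤ[X]) + 1) * hermite m := by
  induction m with
  | zero => simp
  | succ m ih =>
    rw [hermite_succ (m + 1), derivative_sub, derivative_mul, ih, derivative_X, hermite_succ m]
    have h : derivative (((m : ℤ[X]) + 1) * hermite m) =
        ((m : ℤ[X]) + 1) * derivative (hermite m) := by
      rw [derivative_mul]; simp
    rw [h]
    push_cast
    ring

/-- The probabilists' Hermite polynomial as a real function. -/
noncomputable def hermiteFun (m : ℕ) (x : ℝ) : ℝ := Polynomial.aeval x (Polynomial.hermite m)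

theorem hermiteFun_zero (x : ℝ) : hermiteFun 0 x = 1 := by simp [hermiteFun]

/-- Creation and annihilation in one variable. At `m = 0` the truncated index `m - 1` is harmless
because its coefficient vanishes. -/
theorem mul_hermiteFun (m : ℕ) (x : ℝ) :
    x * hermiteFun m x = hermiteFun (m + 1) x + m * hermiteFun (m - 1) x := by
  cases m with
  | zero => simp [hermiteFun]
  | succ m =>
    simp only [hermiteFun]
    rw [Polynomial.hermite_succ (m + 1), derivative_hermite_succ]
    simp

theorem integrable_aeval_gaussianReal (P : Polynomial ℝ) :
    Integrable (fun x => Polynomial.aeval x P) (gaussianReal 0 1) := by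
  simp only [Polynomial.aeval_eq_sum_range]
  refine integrable_finsetSum _ fun i _ => Integrable.smul (f := fun x : ℝ => x ^ i) (P.coeff i) ?_
  have h := (memLp_id_gaussianReal (μ := 0) (v := 1) (i : NNReal)).integrable_norm_pow'
  refine (integrable_norm_iff (by fun_prop)).1 ?_
  simpa using h

theorem integrable_hermiteFun (m : ℕ) : Integrable (hermiteFun m) (gaussianReal 0 1) := by
  have h := integrable_aeval_gaussianReal ((Polynomial.hermite m).map (Int.castRingHom ℝ))
  refine h.congr (Eventually.of_forall fun x => ?_)
  simp [hermiteFun, Polynomial.aeval_def, Polynomial.eval₂_map]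

theorem integrable_mul_gaussianPDFReal {f : ℝ → ℝ} (hf : Integrable f (gaussianReal 0 1)) :
    Integrable (fun x => gaussianPDFReal 0 1 x * f x) := by
  rw [gaussianReal_of_var_ne_zero _ one_ne_zero,
    integrable_withDensity_iff_integrable_smul' (by fun_prop) (by simp [gaussianPDF])] at hf
  refine hf.congr (Eventually.of_forall fun x => ?_)
  simp [gaussianPDF, ENNReal.toReal_ofReal (gaussianPDFReal_nonneg 0 1 x)]

theorem integral_hermiteFun (m : ℕ) :
    ∫ x, hermiteFun m x ∂(gaussianReal 0 1) = if m = 0 then 1 else 0 := by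
  cases m with
  | zero => simp [hermiteFun]
  | succ m =>
    rw [integral_gaussianReal_eq_integral_smul one_ne_zero]
    have hpdf : ∀ x : ℝ, HasDerivAt (gaussianPDFReal 0 1) (-x * gaussianPDFReal 0 1 x) x := by
      intro x
      have h2 : HasDerivAt (fun y : ℝ => -(y - 0) ^ 2 / (2 * ((1 : NNReal) : ℝ))) (-x) x := by
        have := ((((hasDerivAt_id x).sub_const 0).pow 2).neg).div_const (2 * ((1 : NNReal) : ℝ))
        exact this.congr_deriv (by simp; ring)
      have := h2.exp.const_mul (√(2 * Real.pi * ((1 : NNReal) : ℝ)))⁻¹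
      unfold gaussianPDFReal
      exact this.congr_deriv (by ring)
    have hH : ∀ x : ℝ, HasDerivAt (hermiteFun m)
        (Polynomial.aeval x (Polynomial.derivative (Polynomial.hermite m))) x :=
      fun x => Polynomial.hasDerivAt_aeval _ x
    -- For the density `φ`, `φ·H_{m+1} = -(φ·H_m)'`, and an integrable function with integrable
    -- derivative has derivative of integral zero.
    have hder : ∀ x : ℝ, HasDerivAt (fun y => gaussianPDFReal 0 1 y * hermiteFun m y)
        (-(gaussianPDFReal 0 1 x • hermiteFun (m + 1) x)) x := by
      intro x
      refine ((hpdf x).mul (hH x)).congr_deriv ?_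
      simp only [hermiteFun, Polynomial.hermite_succ, map_sub, map_mul, Polynomial.aeval_X,
        smul_eq_mul]
      ring
    have h := integral_eq_zero_of_hasDerivAt_of_integrable hder
      (by simpa using (integrable_mul_gaussianPDFReal (integrable_hermiteFun (m + 1))).neg)
      (integrable_mul_gaussianPDFReal (integrable_hermiteFun m))
    rw [integral_neg, neg_eq_zero] at h
    simpa using h

/-! ### Polynomials in the entries of the tensor -/

/-- Functions of the tensor given by a polynomial in its entries. -/
def IsPoly {n r : ℕ} (f : SymTensor n r → ℝ) : Prop :=
  ∃ P : MvPolynomial (Subsets n r) ℝ, ∀ G, f G = MvPolynomial.eval G P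

namespace IsPoly

variable {n r : ℕ} {f g : SymTensor n r → ℝ}

theorem const (a : ℝ) : IsPoly (fun _ : SymTensor n r => a) := ⟨MvPolynomial.C a, by simp⟩

theorem mul (hf : IsPoly f) (hg : IsPoly g) : IsPoly (fun G => f G * g G) := by
  obtain ⟨P, hP⟩ := hf
  obtain ⟨Q, hQ⟩ := hg
  exact ⟨P * Q, by simp [hP, hQ]⟩

theorem sum {ι : Type*} (s : Finset ι) {f : ι → SymTensor n r → ℝ} (h : ∀ i ∈ s, IsPoly (f i)) :
    IsPoly (fun G => ∑ i ∈ s, f i G) := by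
  classical
  induction s using Finset.induction_on with
  | empty => simpa using const 0
  | insert i s hi ih =>
    obtain ⟨P, hP⟩ := h i (Finset.mem_insert_self i s)
    obtain ⟨Q, hQ⟩ := ih fun j hj => h j (Finset.mem_insert_of_mem hj)
    exact ⟨P + Q, fun G => by
      rw [map_add, ← hP, ← hQ]
      exact Finset.sum_insert hi⟩

theorem prod {ι : Type*} (s : Finset ι) {f : ι → SymTensor n r → ℝ} (h : ∀ i ∈ s, IsPoly (f i)) :
    IsPoly (fun G => ∏ i ∈ s, f i G) := by
  classical
  induction s using Finset.induction_on with
  | empty => simpa using const 1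
  | insert i s hi ih =>
    simp only [Finset.prod_insert hi]
    exact (h i (Finset.mem_insert_self i s)).mul (ih fun j hj => h j (Finset.mem_insert_of_mem hj))

theorem entry (A : Finset (Fin n)) : IsPoly (fun G : SymTensor n r => G.entry A) := by
  by_cases h : A.card = r
  · exact ⟨MvPolynomial.X ⟨A, h⟩, by simp [SymTensor.entry, h]⟩
  · simpa [SymTensor.entry, h] using const 0

theorem hermiteFun (m : ℕ) (A : Subsets n r) :
    IsPoly (fun G : SymTensor n r => hermiteFun m (G A)) := by
  refine ⟨Polynomial.aeval (MvPolynomial.X A) (Polynomial.hermite m), fun G => ?_⟩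
  have := Polynomial.hom_eval₂ (Polynomial.hermite m) (algebraMap ℤ (MvPolynomial (Subsets n r) ℝ))
    (MvPolynomial.eval G) (MvPolynomial.X A)
  rw [Polynomial.aeval_def, this]
  rw [MvPolynomial.eval_X]
  change Polynomial.aeval (G A) (Polynomial.hermite m) = _
  rw [Polynomial.aeval_def]
  congr 1
  exact RingHom.ext_int _ _

theorem integrable (hf : IsPoly f) : Integrable f (gaussianTensor n r) := by
  obtain ⟨P, hP⟩ := hf
  have hf : f = fun G => MvPolynomial.eval G P := funext hP
  simp only [hf, MvPolynomial.eval_eq']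
  refine integrable_finsetSum _ fun d _ => Integrable.const_mul ?_ _
  refine Integrable.fintype_prod (f := fun (i : Subsets n r) (x : ℝ) => x ^ d i) fun i => ?_
  simpa using integrable_aeval_gaussianReal (Polynomial.X ^ d i)

end IsPoly

/-- The product of Hermite polynomials of the entries, with degrees given by `c`. -/
noncomputable def hermiteProd {n r : ℕ} (c : Finset (Fin n) → ℕ) (G : SymTensor n r) : ℝ :=
  ∏ A : Subsets n r, hermiteFun (c A.1) (G A)

theorem isPoly_hermiteProd {n r : ℕ} (c : Finset (Fin n) → ℕ) :
    IsPoly (hermiteProd c : SymTensor n r → ℝ) :=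
  IsPoly.prod _ fun _ _ => IsPoly.hermiteFun _ _

theorem integral_hermiteProd {n r : ℕ} {c : Finset (Fin n) → ℕ} (hc : ∀ A, c A ≠ 0 → A.card = r) :
    ∫ G, hermiteProd c G ∂(gaussianTensor n r) = if c = 0 then 1 else 0 := by
  unfold hermiteProd gaussianTensor
  rw [integral_fintype_prod_eq_prod (f := fun (A : Subsets n r) x => hermiteFun (c A.1) x)]
  simp only [integral_hermiteFun]
  split_ifs with h
  · simp [h]
  · obtain ⟨A, hA⟩ := Function.ne_iff.1 h
    exact Finset.prod_eq_zero (Finset.mem_univ (⟨A, hc A hA⟩ : Subsets n r)) (if_neg hA)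

theorem entry_mul_hermiteProd {n r : ℕ} (c : Finset (Fin n) → ℕ) {e : Finset (Fin n)}
    (he : e.card = r) (G : SymTensor n r) :
    G.entry e * hermiteProd c G =
      hermiteProd (c + Pi.single e 1) G + c e * hermiteProd (c - Pi.single e 1) G := by
  unfold hermiteProd
  have hmem : (⟨e, he⟩ : Subsets n r) ∈ Finset.univ := Finset.mem_univ _
  have hne : ∀ A ∈ (Finset.univ : Finset (Subsets n r)).erase ⟨e, he⟩, A.1 ≠ e := by
    intro A hA h
    exact (Finset.mem_erase.1 hA).1 (Subtype.ext h)
  have h1 : ∀ A ∈ (Finset.univ : Finset (Subsets n r)).erase ⟨e, he⟩,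
      hermiteFun ((c + Pi.single e 1 : Finset (Fin n) → ℕ) A.1) (G A) =
        hermiteFun (c A.1) (G A) := by
    intro A hA
    rw [Pi.add_apply, Pi.single_eq_of_ne (hne A hA), add_zero]
  have h2 : ∀ A ∈ (Finset.univ : Finset (Subsets n r)).erase ⟨e, he⟩,
      hermiteFun ((c - Pi.single e 1 : Finset (Fin n) → ℕ) A.1) (G A) =
        hermiteFun (c A.1) (G A) := by
    intro A hA
    rw [Pi.sub_apply, Pi.single_eq_of_ne (hne A hA), Nat.sub_zero]
  rw [← Finset.mul_prod_erase _ _ hmem, ← Finset.mul_prod_erase _ _ hmem,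
    ← Finset.mul_prod_erase _ _ hmem, Finset.prod_congr rfl h1, Finset.prod_congr rfl h2]
  have h := mul_hermiteFun (c e) (G ⟨e, he⟩)
  simp only [SymTensor.entry, he, dif_pos, Pi.add_apply, Pi.sub_apply, Pi.single_eq_same]
  rw [← mul_assoc, h]
  ring

/-- Multiplication of a Hermite product by two different entries creates or annihilates
each of the two hyperedges. -/
theorem entry_mul_entry_mul_hermiteProd {n r : ℕ} (c : Finset (Fin n) → ℕ) {e f : Finset (Fin n)}
    (he : e.card = r) (hf : f.card = r) (hef : e ≠ f) (G : SymTensor n r) :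
    G.entry e * G.entry f * hermiteProd c G =
      hermiteProd (c + Pi.single f 1 + Pi.single e 1) G +
      c e * hermiteProd (c + Pi.single f 1 - Pi.single e 1) G +
      c f * hermiteProd (c - Pi.single f 1 + Pi.single e 1) G +
      c f * c e * hermiteProd (c - Pi.single f 1 - Pi.single e 1) G := by
  rw [mul_assoc, entry_mul_hermiteProd c hf, mul_add, entry_mul_hermiteProd _ he, mul_left_comm,
    entry_mul_hermiteProd _ he]
  simp only [Pi.add_apply, Pi.sub_apply, Pi.single_eq_of_ne hef, add_zero, Nat.sub_zero]
  ring

/-! ### The spectral norm and traces of powers -/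

theorem spectralNorm_sq_le {ι : Type*} [Fintype ι] [DecidableEq ι] (A : Matrix ι ι ℝ) :
    spectralNorm A ^ 2 ≤ ∑ i, ∑ j, A i j ^ 2 := by
  have h0 : 0 ≤ ∑ i, ∑ j, A i j ^ 2 :=
    Finset.sum_nonneg fun i _ => Finset.sum_nonneg fun j _ => sq_nonneg _
  have h : spectralNorm A ≤ √(∑ i, ∑ j, A i j ^ 2) := by
    refine ContinuousLinearMap.opNorm_le_bound _ (Real.sqrt_nonneg _) fun x => ?_
    rw [EuclideanSpace.norm_eq, EuclideanSpace.norm_eq, ← Real.sqrt_mul h0]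
    refine Real.sqrt_le_sqrt ?_
    rw [Finset.sum_mul]
    refine Finset.sum_le_sum fun i _ => ?_
    simp only [Real.norm_eq_abs, sq_abs, Matrix.ofLp_toEuclideanCLM, Matrix.mulVec, dotProduct]
    exact Finset.sum_mul_sq_le_sq_mul_sq _ _ _
  calc spectralNorm A ^ 2 ≤ √(∑ i, ∑ j, A i j ^ 2) ^ 2 :=
        pow_le_pow_left₀ (norm_nonneg _) h 2
    _ = _ := Real.sq_sqrt h0

/-- The trace of the square of `A ^ 2 ^ m` is its squared Frobenius norm. Exponents are powers of
two because the C*-identity, iterated by squaring, then gives `‖A ^ 2 ^ m‖ = ‖A‖ ^ 2 ^ m`. -/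
theorem spectralNorm_pow_le_trace {ι : Type*} [Fintype ι] [DecidableEq ι] {A : Matrix ι ι ℝ}
    (hA : A.IsSymm) (m : ℕ) : spectralNorm A ^ (2 * 2 ^ m) ≤ (A ^ (2 * 2 ^ m)).trace := by
  have hsa : IsSelfAdjoint (Matrix.toEuclideanCLM (𝕜 := ℝ) A) := by
    have : IsSelfAdjoint A := by
      rw [IsSelfAdjoint, Matrix.star_eq_conjTranspose, Matrix.conjTranspose_eq_transpose_of_trivial]
      exact hA
    exact this.map _
  have h1 : spectralNorm (A ^ 2 ^ m) = spectralNorm A ^ 2 ^ m := by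
    unfold spectralNorm
    rw [map_pow, hsa.norm_pow_two_pow]
  rw [mul_comm 2, pow_mul, pow_mul, ← h1]
  refine (spectralNorm_sq_le _).trans_eq ?_
  have hs : (A ^ 2 ^ m).IsSymm := hA.pow _
  simp only [pow_two (A ^ 2 ^ m), Matrix.trace, Matrix.diag, Matrix.mul_apply]
  refine Finset.sum_congr rfl fun i _ => Finset.sum_congr rfl fun j _ => ?_
  rw [hs.apply i j, pow_two]

theorem measure_spectralNorm_le {n r : ℕ} {ι : Type*} [Fintype ι] [DecidableEq ι]
    {M : SymTensor n r → Matrix ι ι ℝ} (hsymm : ∀ G, (M G).IsSymm)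
    (m : ℕ) (hint : Integrable (fun G => ((M G) ^ (2 * 2 ^ m)).trace) (gaussianTensor n r))
    {Λ B : ℝ} (hΛ : 0 < Λ)
    (hB : ∫ G, ((M G) ^ (2 * 2 ^ m)).trace ∂(gaussianTensor n r) ≤ B * Λ ^ (2 * 2 ^ m)) :
    1 - B / 2 ^ (2 * 2 ^ m) ≤ (gaussianTensor n r).real {G | spectralNorm (M G) ≤ 2 * Λ} := by
  have : IsProbabilityMeasure (gaussianTensor n r) := by unfold gaussianTensor; infer_instance
  set q := 2 * 2 ^ m
  have hpow : ∀ G, spectralNorm (M G) ^ q ≤ ((M G) ^ q).trace :=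
    fun G => spectralNorm_pow_le_trace (hsymm G) m
  have hmarkov := mul_meas_ge_le_integral_of_nonneg (μ := gaussianTensor n r)
    (Eventually.of_forall fun G => (pow_nonneg (norm_nonneg _) q).trans (hpow G)) hint
    ((2 * Λ) ^ q)
  set t : Set (SymTensor n r) := {G | (2 * Λ) ^ q ≤ ((M G) ^ q).trace} with ht
  have hle : (gaussianTensor n r).real t ≤ B / 2 ^ q := by
    rw [le_div_iff₀ (by positivity)]
    have h := hmarkov.trans hB
    rw [mul_pow] at h
    have hpos : 0 < Λ ^ q := by positivity
    refine le_of_mul_le_mul_right ?_ hpos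
    calc _ = 2 ^ q * Λ ^ q * (gaussianTensor n r).real t := by ring
      _ ≤ _ := h
  have hunion : (Set.univ : Set (SymTensor n r)) ⊆ {G | spectralNorm (M G) ≤ 2 * Λ} ∪ t := by
    intro G _
    by_cases hG : spectralNorm (M G) ≤ 2 * Λ
    · exact Or.inl hG
    · refine Or.inr ?_
      exact (pow_le_pow_left₀ (by positivity) (not_le.1 hG).le q).trans (hpow G)
  have h1 := (measureReal_mono hunion).trans
    (measureReal_union_le (μ := gaussianTensor n r) _ t)
  rw [probReal_univ] at h1
  linarith

/-! ### Elementary counting -/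

/-- The increasing enumeration embeds `k`-subsets into `k`-tuples, whose products expand the power.
-/
theorem sum_powersetCard_prod_le {n : ℕ} (a : Fin n → ℝ) (ha : ∀ v, 0 ≤ a v) (k : ℕ) :
    ∑ T ∈ Finset.powersetCard k Finset.univ, ∏ v ∈ T, a v ≤ (∑ v, a v) ^ k := by
  rw [Fintype.sum_pow, ← Finset.sum_coe_sort]
  have hcard : ∀ T : (Finset.powersetCard k (Finset.univ : Finset (Fin n))), T.1.card = k :=
    fun T => (Finset.mem_powersetCard.1 T.2).2
  set i : (Finset.powersetCard k (Finset.univ : Finset (Fin n))) → (Fin k → Fin n) :=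
    fun T => T.1.orderEmbOfFin (hcard T) with hi
  have himg : ∀ T, Finset.univ.image (i T) = T.1 := fun T => by
    simp [hi]
  have hinj : Function.Injective i := by
    intro T T' h
    apply Subtype.ext
    rw [← himg T, ← himg T', h]
  calc ∑ T : (Finset.powersetCard k (Finset.univ : Finset (Fin n))), ∏ v ∈ T.1, a v
      = ∑ T, ∏ j, a (i T j) := by
        refine Finset.sum_congr rfl fun T _ => ?_
        conv_lhs => rw [← himg T]
        exact Finset.prod_image fun x _ y _ h => (T.1.orderEmbOfFin (hcard T)).injective h
    _ = ∑ g ∈ Finset.univ.image i, ∏ j, a (g j) :=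
        (Finset.sum_image (f := fun g : Fin k → Fin n => ∏ j, a (g j))
          fun x _ y _ h => hinj h).symm
    _ ≤ _ := Finset.sum_le_sum_of_subset_of_nonneg (Finset.subset_univ _)
        fun g _ _ => Finset.prod_nonneg fun j _ => ha _

theorem sum_le_sum_of_injOn {α β : Type*} [Fintype β] [DecidableEq β] {s : Finset α} (i : α → β)
    (hi : Set.InjOn i s) {f : α → ℝ} {g : β → ℝ} (hfg : ∀ a ∈ s, f a ≤ g (i a))
    (hg : ∀ b, 0 ≤ g b) : ∑ a ∈ s, f a ≤ ∑ b, g b :=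
  calc ∑ a ∈ s, f a ≤ ∑ a ∈ s, g (i a) := Finset.sum_le_sum hfg
    _ = ∑ b ∈ s.image i, g b := (Finset.sum_image hi).symm
    _ ≤ _ := Finset.sum_le_sum_of_subset_of_nonneg (Finset.subset_univ _) fun b _ _ => hg b

/-- The factor `u` for each vertex outside `X`. -/
noncomputable def freshWeight {n : ℕ} (X : Finset (Fin n)) (u : ℝ) (v : Fin n) : ℝ :=
  if v ∈ X then 1 else u

theorem freshWeight_nonneg {n : ℕ} (X : Finset (Fin n)) {u : ℝ} (hu : 0 ≤ u) (v : Fin n) :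
    0 ≤ freshWeight X u v := by
  unfold freshWeight; split_ifs <;> simp [hu]

theorem sum_freshWeight_le {n : ℕ} (X : Finset (Fin n)) {u : ℝ} (hu : 0 ≤ u) :
    ∑ v, freshWeight X u v ≤ n * u + X.card := by
  calc ∑ v, freshWeight X u v ≤ ∑ v : Fin n, (u + if v ∈ X then 1 else 0) := by
        refine Finset.sum_le_sum fun v _ => ?_
        unfold freshWeight
        split_ifs <;> linarith
    _ = _ := by simp [Finset.sum_add_distrib]

/-- Bookkeeping for the vertex part of the weight: a step loses at most the vertices of `K`, each a
factor `u⁻¹`, and each vertex of `F` not already present gains a factor `u`. -/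
theorem pow_card_mul_pow_le {n : ℕ} {X X' F K : Finset (Fin n)} {u : ℝ} (hu : 0 < u) (hu1 : u ≤ 1)
    {m : ℕ} (hK : K.card ≤ m) (h : (X \ K) ∪ F ⊆ X') :
    u ^ X'.card * u ^ m ≤ u ^ X.card * ∏ v ∈ F, freshWeight X u v := by
  have h1 : ∏ v ∈ F, freshWeight X u v = u ^ (F \ X).card := by
    unfold freshWeight
    rw [Finset.prod_ite, Finset.prod_const_one, one_mul, Finset.prod_const]
    congr 2
    ext v
    simp
  rw [h1, ← pow_add, ← pow_add]
  refine pow_le_pow_of_le_one hu.le hu1 ?_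
  have h2 : (X \ K) ∪ (F \ X) ⊆ X' :=
    (Finset.union_subset_union_right Finset.sdiff_subset).trans h
  have h3 := Finset.card_le_card h2
  rw [Finset.card_union_of_disjoint
    (Finset.disjoint_of_subset_left Finset.sdiff_subset Finset.disjoint_sdiff)] at h3
  have h4 := Finset.le_card_sdiff K X
  omega

/-! ### Moves -/

/-- The data `((S₁, S₂), (T₁, T₂), t)` of one summand in an entry of the Kikuchi matrix. -/
abbrev Move (n : ℕ) : Type :=
  (Finset (Fin n) × Finset (Fin n)) × (Finset (Fin n) × Finset (Fin n)) × Fin n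

namespace Move

variable {n : ℕ}

/-- The first hyperedge `S₁ ∪ T₁ ∪ {t}` of a move. -/
def fst (o : Move n) : Finset (Fin n) := o.1.1 ∪ o.2.1.1 ∪ {o.2.2}

/-- The second hyperedge `S₂ ∪ T₂ ∪ {t}` of a move. -/
def snd (o : Move n) : Finset (Fin n) := o.1.2 ∪ o.2.1.2 ∪ {o.2.2}

/-- The set reached from `S` by a move. -/
def target (S : Finset (Fin n)) (o : Move n) : Finset (Fin n) :=
  (S \ (o.1.1 ∪ o.1.2)) ∪ (o.2.1.1 ∪ o.2.1.2)

/-- Exchange of the two hyperedges. -/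
def swap (o : Move n) : Move n := (o.1.swap, o.2.1.swap, o.2.2)

end Move

/-- The moves that can be applied to `S`. -/
structure IsMove {n : ℕ} (k : ℕ) (S : Finset (Fin n)) (o : Move n) : Prop where
  sub₁ : o.1.1 ⊆ S
  sub₂ : o.1.2 ⊆ S
  card_s₁ : o.1.1.card = k
  card_s₂ : o.1.2.card = k
  card_t₁ : o.2.1.1.card = k
  card_t₂ : o.2.1.2.card = k
  disj_s : Disjoint o.1.1 o.1.2
  disj_t : Disjoint o.2.1.1 o.2.1.2
  disj₁ : Disjoint o.2.1.1 S
  disj₂ : Disjoint o.2.1.2 S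
  notMem : o.2.2 ∉ S
  notMem₁ : o.2.2 ∉ o.2.1.1
  notMem₂ : o.2.2 ∉ o.2.1.2

namespace IsMove

variable {n k : ℕ} {S : Finset (Fin n)} {o : Move n}

theorem swap (h : IsMove k S o) : IsMove k S o.swap :=
  ⟨h.sub₂, h.sub₁, h.card_s₂, h.card_s₁, h.card_t₂, h.card_t₁, h.disj_s.symm, h.disj_t.symm,
    h.disj₂, h.disj₁, h.notMem, h.notMem₂, h.notMem₁⟩

theorem s₁_eq (h : IsMove k S o) : o.1.1 = o.fst ∩ S := by
  ext v
  have h1 := @h.sub₁ v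
  have h2 : v ∈ o.2.1.1 → v ∉ S := fun hv => Finset.disjoint_left.1 h.disj₁ hv
  have h3 := h.notMem
  simp only [Move.fst, Finset.mem_inter, Finset.mem_union, Finset.mem_singleton]
  grind

theorem t₁_eq (h : IsMove k S o) : o.2.1.1 = o.fst \ (S ∪ {o.2.2}) := by
  ext v
  have h1 := @h.sub₁ v
  have h2 : v ∈ o.2.1.1 → v ∉ S := fun hv => Finset.disjoint_left.1 h.disj₁ hv
  have h3 := h.notMem₁
  simp only [Move.fst, Finset.mem_sdiff, Finset.mem_union, Finset.mem_singleton]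
  grind

theorem s₂_eq (h : IsMove k S o) : o.1.2 = o.snd ∩ S := h.swap.s₁_eq

theorem t₂_eq (h : IsMove k S o) : o.2.1.2 = o.snd \ (S ∪ {o.2.2}) := h.swap.t₁_eq

theorem card_fst (h : IsMove k S o) : o.fst.card = 2 * k + 1 := by
  unfold Move.fst
  rw [Finset.card_union_of_disjoint, Finset.card_union_of_disjoint, h.card_s₁, h.card_t₁,
    Finset.card_singleton]
  · omega
  · exact (Finset.disjoint_of_subset_right h.sub₁ h.disj₁).symm
  · rw [Finset.disjoint_singleton_right, Finset.mem_union]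
    exact fun h' => h'.elim (fun h1 => h.notMem (h.sub₁ h1)) h.notMem₁

theorem card_snd (h : IsMove k S o) : o.snd.card = 2 * k + 1 := h.swap.card_fst

theorem mem_fst (o : Move n) : o.2.2 ∈ o.fst := by simp [Move.fst]

theorem mem_snd (o : Move n) : o.2.2 ∈ o.snd := by simp [Move.snd]

theorem notMem_snd (h : IsMove k S o) {v : Fin n} (hv : v ∈ o.1.1) : v ∉ o.snd := by
  have h1 := h.sub₁ hv
  have h2 : v ∈ o.2.1.2 → v ∉ S := fun hv => Finset.disjoint_left.1 h.disj₂ hv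
  have h3 := h.notMem
  have h4 := Finset.disjoint_left.1 h.disj_s hv
  simp only [Move.snd, Finset.mem_union, Finset.mem_singleton]
  grind

theorem fst_ne_snd (h : IsMove k S o) (hk : 1 ≤ k) : o.fst ≠ o.snd := by
  obtain ⟨v, hv⟩ := Finset.card_pos.1 (h.card_s₁.symm ▸ hk : 0 < o.1.1.card)
  intro he
  exact h.notMem_snd hv (he ▸ by simp [Move.fst, hv])

/-- Since `S` is known, intersecting each hyperedge with `S` recovers `S₁` and `S₂`, and removing
`S` and `t` recovers `T₁` and `T₂`. All counts of annihilating moves rest on this. -/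
theorem ext {o' : Move n} (h : IsMove k S o) (h' : IsMove k S o') (h1 : o.fst = o'.fst)
    (h2 : o.snd = o'.snd) (ht : o.2.2 = o'.2.2) : o = o' :=
  Prod.ext (Prod.ext (by rw [h.s₁_eq, h'.s₁_eq, h1]) (by rw [h.s₂_eq, h'.s₂_eq, h2]))
    (Prod.ext (Prod.ext (by rw [h.t₁_eq, h'.t₁_eq, h1, ht]) (by rw [h.t₂_eq, h'.t₂_eq, h2, ht])) ht)

end IsMove

open Classical in
/-- The finite set of moves that can be applied to `S`. -/
noncomputable def moves {n : ℕ} (k : ℕ) (S : Finset (Fin n)) : Finset (Move n) :=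
  Finset.univ.filter (IsMove k S)

theorem mem_moves {n k : ℕ} {S : Finset (Fin n)} {o : Move n} : o ∈ moves k S ↔ IsMove k S o := by
  simp [moves]

theorem sum_moves_swap {n k : ℕ} {S : Finset (Fin n)} (F : Move n → ℝ) :
    ∑ o ∈ moves k S, F o.swap = ∑ o ∈ moves k S, F o :=
  Finset.sum_nbij' Move.swap Move.swap (fun _ ho => mem_moves.2 (mem_moves.1 ho).swap)
    (fun _ ho => mem_moves.2 (mem_moves.1 ho).swap) (fun _ _ => rfl) (fun _ _ => rfl)
    (fun _ _ => rfl)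

/-! ### Weights of states -/

/-- The number of hyperedges in `c`, with multiplicity. -/
def mass {n : ℕ} (c : Finset (Fin n) → ℕ) : ℕ := ∑ A, c A

open Classical in
/-- The vertices covered by the hyperedges in `c`. -/
noncomputable def vertices {n : ℕ} (c : Finset (Fin n) → ℕ) : Finset (Fin n) :=
  Finset.univ.filter fun v => ∃ A, c A ≠ 0 ∧ v ∈ A

theorem mem_vertices {n : ℕ} {c : Finset (Fin n) → ℕ} {v : Fin n} :
    v ∈ vertices c ↔ ∃ A, c A ≠ 0 ∧ v ∈ A := by simp [vertices]

theorem mass_add_single {n : ℕ} (c : Finset (Fin n) → ℕ) (e : Finset (Fin n)) :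
    mass (c + Pi.single e 1) = mass c + 1 := by
  simp [mass, Finset.sum_add_distrib]

theorem mass_sub_single {n : ℕ} {c : Finset (Fin n) → ℕ} {e : Finset (Fin n)} (he : c e ≠ 0) :
    mass (c - Pi.single e 1) + 1 = mass c := by
  rw [← mass_add_single _ e]
  congr 1
  funext A
  by_cases h : A = e
  · subst h; simp; omega
  · simp [Pi.single_eq_of_ne h]

theorem card_vertices_le {n r : ℕ} {c : Finset (Fin n) → ℕ} (hc : ∀ A, c A ≠ 0 → A.card = r) :
    (vertices c).card ≤ r * mass c := by
  have h : vertices c ⊆ (Finset.univ.filter fun A => c A ≠ 0).biUnion id := by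
    intro v hv
    simpa [mem_vertices] using hv
  refine (Finset.card_le_card h).trans (Finset.card_biUnion_le.trans ?_)
  unfold mass
  rw [Finset.mul_sum]
  refine (Finset.sum_le_sum (g := fun A => r * c A) fun A hA => ?_).trans
    (Finset.sum_le_sum_of_subset (Finset.filter_subset _ _))
  have hA' := (Finset.mem_filter.1 hA).2
  rw [id, hc A hA']
  exact Nat.le_mul_of_pos_right _ (Nat.pos_of_ne_zero hA')

/-- The weight of the state `(S, c)`. -/
noncomputable def weight {n : ℕ} (κ u : ℝ) (S : Finset (Fin n)) (c : Finset (Fin n) → ℕ) : ℝ :=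
  κ ^ mass c * u ^ (S ∪ vertices c).card

section Pointwise

variable {n k : ℕ} {S : Finset (Fin n)} {o : Move n} {c : Finset (Fin n) → ℕ} {κ u : ℝ}

theorem weight_nonneg (hκ : 0 < κ) (hu : 0 < u) (S : Finset (Fin n)) (c : Finset (Fin n) → ℕ) :
    0 ≤ weight κ u S c := by unfold weight; positivity

theorem weight_create_create_le (hκ : 0 < κ) (hu : 0 < u) (hu1 : u ≤ 1) (h : IsMove k S o) :
    weight κ u (o.target S) (c + Pi.single o.snd 1 + Pi.single o.fst 1) ≤
      κ ^ 2 * weight κ u S c * ((∏ v ∈ o.2.1.1, freshWeight (S ∪ vertices c) u v) *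
        ((∏ v ∈ o.2.1.2, freshWeight (S ∪ vertices c) u v) *
          freshWeight (S ∪ vertices c) u o.2.2)) := by
  -- No vertex is lost: those leaving `S` are covered by the created hyperedges.
  have hsub : ((S ∪ vertices c) \ ∅) ∪ (o.2.1.1 ∪ (o.2.1.2 ∪ {o.2.2})) ⊆
      o.target S ∪ vertices (c + Pi.single o.snd 1 + Pi.single o.fst 1) := by
    have h1 : o.fst ⊆ vertices (c + Pi.single o.snd 1 + Pi.single o.fst 1) :=
      fun v hv => mem_vertices.2 ⟨o.fst, by simp, hv⟩
    have h2 : o.snd ⊆ vertices (c + Pi.single o.snd 1 + Pi.single o.fst 1) :=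
      fun v hv => mem_vertices.2 ⟨o.snd, by simp, hv⟩
    have h3 : vertices c ⊆ vertices (c + Pi.single o.snd 1 + Pi.single o.fst 1) := by
      intro v hv
      obtain ⟨A, hA, hvA⟩ := mem_vertices.1 hv
      exact mem_vertices.2 ⟨A, by simp [hA], hvA⟩
    intro v hv
    have h1' := @h1 v
    have h2' := @h2 v
    have h3' := @h3 v
    simp only [Move.fst, Move.snd, Move.target, Finset.mem_union, Finset.mem_sdiff,
      Finset.mem_singleton, Finset.notMem_empty] at *
    grind
  have hw := pow_card_mul_pow_le hu hu1 (m := 0) (le_of_eq Finset.card_empty) hsub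
  rw [Finset.prod_union, Finset.prod_union, Finset.prod_singleton, pow_zero, mul_one] at hw
  · unfold weight
    rw [mass_add_single, mass_add_single]
    rw [pow_succ, pow_succ, mul_assoc (κ ^ mass c), ← pow_two]
    refine (mul_le_mul_of_nonneg_left hw (by positivity)).trans_eq ?_
    ring
  · exact Finset.disjoint_singleton_right.2 h.notMem₂
  · exact Finset.disjoint_union_right.2 ⟨h.disj_t, Finset.disjoint_singleton_right.2 h.notMem₁⟩

theorem weight_annihilate_create_le (hκ : 0 < κ) (hu : 0 < u) (hu1 : u ≤ 1) (hk : 1 ≤ k)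
    (h : IsMove k S o) (hc : c o.fst ≠ 0) :
    weight κ u (o.target S) (c + Pi.single o.snd 1 - Pi.single o.fst 1) * u ^ k ≤
      weight κ u S c * ∏ v ∈ o.2.1.2, freshWeight (S ∪ vertices c) u v := by
  have hne := h.fst_ne_snd hk
  -- Only `S₁` can be lost: `S₂` and `t` lie in the created hyperedge, and `T₁` lies in the target.
  have hsub : ((S ∪ vertices c) \ o.1.1) ∪ o.2.1.2 ⊆
      o.target S ∪ vertices (c + Pi.single o.snd 1 - Pi.single o.fst 1) := by
    have h2 : o.snd ⊆ vertices (c + Pi.single o.snd 1 - Pi.single o.fst 1) :=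
      fun v hv => mem_vertices.2 ⟨o.snd, by simp [Pi.single_eq_of_ne hne.symm], hv⟩
    have h3 : vertices c ⊆ vertices (c + Pi.single o.snd 1 - Pi.single o.fst 1) ∪ o.fst := by
      intro v hv
      obtain ⟨A, hA, hvA⟩ := mem_vertices.1 hv
      by_cases hAe : A = o.fst
      · exact Finset.mem_union_right _ (hAe ▸ hvA)
      · exact Finset.mem_union_left _ (mem_vertices.2
          ⟨A, by simp [Pi.single_eq_of_ne hAe]; omega, hvA⟩)
    intro v hv
    have h2' := @h2 v
    have h3' := @h3 v
    simp only [Move.fst, Move.snd, Move.target, Finset.mem_union, Finset.mem_sdiff,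
      Finset.mem_singleton] at *
    grind
  have hw := pow_card_mul_pow_le hu hu1 h.card_s₁.le hsub
  have hm : mass (c + Pi.single o.snd 1 - Pi.single o.fst 1) = mass c := by
    have := mass_sub_single (c := c + Pi.single o.snd 1) (e := o.fst)
      (by simp [hc])
    rw [mass_add_single] at this
    omega
  unfold weight
  rw [hm, mul_assoc, mul_assoc]
  gcongr

/-- All vertices that leave the state when both hyperedges of the move are annihilated
are covered by no other hyperedge. -/
def IsPrivate (c : Finset (Fin n) → ℕ) (o : Move n) : Prop :=
  ∀ v ∈ o.1.1 ∪ o.1.2 ∪ {o.2.2}, v ∉ vertices (c - Pi.single o.snd 1 - Pi.single o.fst 1)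

open Classical in
theorem weight_annihilate_annihilate_le (hκ : 0 < κ) (hu : 0 < u) (hu1 : u ≤ 1) (hk : 1 ≤ k)
    (h : IsMove k S o) (hc₁ : c o.fst ≠ 0) (hc₂ : c o.snd ≠ 0) :
    weight κ u (o.target S) (c - Pi.single o.snd 1 - Pi.single o.fst 1) *
        (κ ^ 2 * u ^ (2 * k + 1)) ≤
      weight κ u S c * (u + if IsPrivate c o then 1 else 0) := by
  have hne := h.fst_ne_snd hk
  set c' := c - Pi.single o.snd 1 - Pi.single o.fst 1 with hc'
  have h3 : vertices c ⊆ vertices c' ∪ o.fst ∪ o.snd := by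
    intro v hv
    obtain ⟨A, hA, hvA⟩ := mem_vertices.1 hv
    by_cases hAe : A = o.fst
    · exact Finset.mem_union_left _ (Finset.mem_union_right _ (hAe ▸ hvA))
    · by_cases hAf : A = o.snd
      · exact Finset.mem_union_right _ (hAf ▸ hvA)
      · exact Finset.mem_union_left _ (Finset.mem_union_left _ (mem_vertices.2
          ⟨A, by simp [hc', Pi.single_eq_of_ne hAe, Pi.single_eq_of_ne hAf, hA], hvA⟩))
  have hm : mass c' + 2 = mass c := by
    have h1 := mass_sub_single hc₂
    have h2 := mass_sub_single (c := c - Pi.single o.snd 1) (e := o.fst)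
      (by simpa [Pi.single_eq_of_ne hne] using hc₁)
    rw [← hc'] at h2
    omega
  set K := o.1.1 ∪ o.1.2 ∪ {o.2.2} with hK
  have hKc : K.card ≤ 2 * k + 1 := by
    refine (Finset.card_union_le _ _).trans ?_
    have := Finset.card_union_le o.1.1 o.1.2
    rw [h.card_s₁, h.card_s₂] at this
    rw [Finset.card_singleton]
    omega
  -- `T₁` and `T₂` survive in the target, so at most `S₁`, `S₂` and `t` are lost.
  have hsub : (S ∪ vertices c) \ K ⊆ o.target S ∪ vertices c' := by
    intro v hv
    have h3' := @h3 v
    simp only [hK, Move.fst, Move.snd, Move.target, Finset.mem_union, Finset.mem_sdiff,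
      Finset.mem_singleton] at *
    grind
  have key : u ^ (o.target S ∪ vertices c').card * u ^ (2 * k + 1) ≤
      u ^ (S ∪ vertices c).card * (u + if IsPrivate c o then 1 else 0) := by
    split_ifs with hp
    · have hw := pow_card_mul_pow_le (F := ∅) (X := S ∪ vertices c)
        (X' := o.target S ∪ vertices c') hu hu1 hKc (by rw [Finset.union_empty]; exact hsub)
      rw [Finset.prod_empty] at hw
      refine hw.trans ?_
      gcongr
      simpa using hu.le
    -- A vertex `x` of `K` covered by another hyperedge survives, so only `2k` vertices can be lost;
    -- this saves one factor `u`.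
    · unfold IsPrivate at hp
      push Not at hp
      obtain ⟨x, hx, hx'⟩ := hp
      have hK' : (K.erase x).card ≤ 2 * k := by
        rw [Finset.card_erase_of_mem hx, ← hK]; omega
      have hw := pow_card_mul_pow_le (F := ∅) (X := S ∪ vertices c)
        (X' := o.target S ∪ vertices c') hu hu1 hK' (by
          rw [Finset.union_empty]
          intro v hv
          by_cases hvx : v = x
          · exact hvx ▸ Finset.mem_union_right _ hx'
          · refine hsub ?_
            rw [Finset.mem_sdiff, Finset.mem_erase] at hv
            exact Finset.mem_sdiff.2 ⟨hv.1, fun h => hv.2 ⟨hvx, h⟩⟩)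
      rw [Finset.prod_empty, mul_one] at hw
      rw [add_zero, pow_succ, ← mul_assoc]
      gcongr
  unfold weight
  rw [← hm, pow_add]
  calc _ = κ ^ mass c' * κ ^ 2 * (u ^ (o.target S ∪ vertices c').card * u ^ (2 * k + 1)) := by ring
    _ ≤ κ ^ mass c' * κ ^ 2 * (u ^ (S ∪ vertices c).card *
        (u + if IsPrivate c o then 1 else 0)) := by gcongr
    _ = _ := by ring

end Pointwise

/-! ### Summation over the moves -/

theorem sum_product_mul {α β : Type*} (s : Finset α) (t : Finset β) (f : α → ℝ) (g : β → ℝ) :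
    ∑ x ∈ s ×ˢ t, f x.1 * g x.2 = (∑ a ∈ s, f a) * ∑ b ∈ t, g b := by
  rw [Finset.sum_product, Finset.sum_mul_sum]

theorem sum_univ_prod_mul {α β : Type*} [Fintype α] [Fintype β] (f : α → ℝ) (g : β → ℝ) :
    ∑ x : α × β, f x.1 * g x.2 = (∑ a, f a) * ∑ b, g b :=
  sum_product_mul Finset.univ Finset.univ f g

section Sums

variable {n k : ℕ} {S : Finset (Fin n)} {c : Finset (Fin n) → ℕ} {κ u : ℝ}

theorem card_powersetCard_le_pow (S : Finset (Fin n)) (k : ℕ) :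
    ((Finset.powersetCard k S).card : ℝ) ≤ (S.card : ℝ) ^ k := by
  rw [Finset.card_powersetCard]
  exact_mod_cast Nat.choose_le_pow S.card k

theorem sum_weight_create_create_le (hκ : 0 < κ) (hu : 0 < u) (hu1 : u ≤ 1) :
    ∑ o ∈ moves k S, weight κ u (o.target S) (c + Pi.single o.snd 1 + Pi.single o.fst 1) ≤
      κ ^ 2 * (S.card : ℝ) ^ (2 * k) * (n * u + (S ∪ vertices c).card) ^ (2 * k + 1) *
        weight κ u S c := by
  set a := freshWeight (S ∪ vertices c) u with ha
  have ha0 : ∀ v, 0 ≤ a v := freshWeight_nonneg _ hu.le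
  set PS := Finset.powersetCard k S with hPS
  set PT := Finset.powersetCard k (Finset.univ : Finset (Fin n)) with hPT
  have hsub : moves k S ⊆ (PS ×ˢ PS) ×ˢ ((PT ×ˢ PT) ×ˢ Finset.univ) := by
    intro o ho
    have h := mem_moves.1 ho
    simp only [Finset.mem_product, hPS, hPT, Finset.mem_powersetCard, Finset.mem_univ, and_true,
      Finset.subset_univ, true_and]
    exact ⟨⟨⟨h.sub₁, h.card_s₁⟩, ⟨h.sub₂, h.card_s₂⟩⟩, ⟨h.card_t₁, h.card_t₂⟩⟩
  have hw := weight_nonneg hκ hu S c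
  have hA : ∑ v, a v ≤ n * u + (S ∪ vertices c).card := sum_freshWeight_le _ hu.le
  have hA0 : 0 ≤ ∑ v, a v := Finset.sum_nonneg fun v _ => ha0 v
  have hT := sum_powersetCard_prod_le a ha0 k
  rw [← hPT] at hT
  have hT0 : 0 ≤ ∑ T ∈ PT, ∏ v ∈ T, a v :=
    Finset.sum_nonneg fun T _ => Finset.prod_nonneg fun v _ => ha0 v
  calc _ ≤ ∑ o ∈ moves k S, κ ^ 2 * weight κ u S c *
          ((∏ v ∈ o.2.1.1, a v) * ((∏ v ∈ o.2.1.2, a v) * a o.2.2)) :=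
        Finset.sum_le_sum fun o ho => weight_create_create_le hκ hu hu1 (mem_moves.1 ho)
    _ ≤ ∑ o ∈ (PS ×ˢ PS) ×ˢ ((PT ×ˢ PT) ×ˢ Finset.univ), κ ^ 2 * weight κ u S c *
          ((∏ v ∈ o.2.1.1, a v) * ((∏ v ∈ o.2.1.2, a v) * a o.2.2)) :=
        Finset.sum_le_sum_of_subset_of_nonneg hsub fun o _ _ =>
          mul_nonneg (by positivity) (mul_nonneg (Finset.prod_nonneg fun v _ => ha0 v)
            (mul_nonneg (Finset.prod_nonneg fun v _ => ha0 v) (ha0 _)))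
    _ = κ ^ 2 * weight κ u S c * ((PS.card : ℝ) * PS.card) *
          ((∑ T ∈ PT, ∏ v ∈ T, a v) * ((∑ T ∈ PT, ∏ v ∈ T, a v) * ∑ v, a v)) := by
        rw [← Finset.mul_sum, Finset.sum_product]
        simp only [Finset.sum_const, Finset.card_product, nsmul_eq_mul, Nat.cast_mul]
        have hsum : ∑ x ∈ (PT ×ˢ PT) ×ˢ Finset.univ,
            (∏ v ∈ x.1.1, a v) * ((∏ v ∈ x.1.2, a v) * a x.2) =
              (∑ T ∈ PT, ∏ v ∈ T, a v) * ((∑ T ∈ PT, ∏ v ∈ T, a v) * ∑ v, a v) := by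
          simp only [← mul_assoc]
          rw [← sum_product_mul PT PT, ← sum_product_mul (PT ×ˢ PT) Finset.univ
            (fun y => (∏ v ∈ y.1, a v) * ∏ v ∈ y.2, a v)]
        rw [hsum]
        ring
    _ ≤ κ ^ 2 * weight κ u S c * ((S.card : ℝ) ^ k * (S.card : ℝ) ^ k) *
          ((n * u + (S ∪ vertices c).card) ^ k * ((n * u + (S ∪ vertices c).card) ^ k *
            (n * u + (S ∪ vertices c).card))) := by
        have hc := card_powersetCard_le_pow S k
        have hT' := hT.trans (pow_le_pow_left₀ hA0 hA k)
        gcongr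
    _ = _ := by ring

theorem sum_mul_ite_mem_le (hc : ∀ A, c A ≠ 0 → A.card = 2 * k + 1) :
    ∑ e : Finset (Fin n), ∑ t : Fin n, (if t ∈ e then (c e : ℝ) else 0) =
      (2 * k + 1) * mass c := by
  simp only [mass, Finset.sum_ite_mem, Finset.univ_inter, Finset.sum_const, nsmul_eq_mul,
    Nat.cast_sum, Finset.mul_sum]
  refine Finset.sum_congr rfl fun e _ => ?_
  by_cases he : c e = 0
  · simp [he]
  · rw [hc e he]; push_cast; ring

theorem sum_weight_annihilate_create_le (hκ : 0 < κ) (hu : 0 < u) (hu1 : u ≤ 1) (hk : 1 ≤ k)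
    (hc : ∀ A, c A ≠ 0 → A.card = 2 * k + 1) :
    (∑ o ∈ moves k S,
        c o.fst * weight κ u (o.target S) (c + Pi.single o.snd 1 - Pi.single o.fst 1)) * u ^ k ≤
      (2 * k + 1) * mass c * (S.card : ℝ) ^ k * (n * u + (S ∪ vertices c).card) ^ k *
        weight κ u S c := by
  set a := freshWeight (S ∪ vertices c) u with ha
  have ha0 : ∀ v, 0 ≤ a v := freshWeight_nonneg _ hu.le
  set PS := Finset.powersetCard k S with hPS
  set PT := Finset.powersetCard k (Finset.univ : Finset (Fin n)) with hPT
  have hw := weight_nonneg hκ hu S c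
  have hA : ∑ v, a v ≤ n * u + (S ∪ vertices c).card := sum_freshWeight_le _ hu.le
  have hA0 : 0 ≤ ∑ v, a v := Finset.sum_nonneg fun v _ => ha0 v
  have hT := sum_powersetCard_prod_le a ha0 k
  rw [← hPT] at hT
  set g : (Finset (Fin n) × Fin n) × (Finset (Fin n) × Finset (Fin n)) → ℝ := fun x =>
    weight κ u S c * ((if x.1.2 ∈ x.1.1 then (c x.1.1 : ℝ) else 0) *
      ((if x.2.1 ∈ PS then 1 else 0) * (if x.2.2 ∈ PT then ∏ v ∈ x.2.2, a v else 0))) with hg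
  have hprod : ∀ T : Finset (Fin n), 0 ≤ ∏ v ∈ T, a v :=
    fun T => Finset.prod_nonneg fun v _ => ha0 v
  -- The annihilated hyperedge is chosen from `c` and `t` from its vertices; only `S₂` and `T₂`
  -- remain free.
  have hinj : Set.InjOn (fun o : Move n => ((o.fst, o.2.2), (o.1.2, o.2.1.2))) (moves k S) := by
    intro o ho o' ho' h
    simp only [Prod.mk.injEq] at h
    obtain ⟨⟨h1, h2⟩, h3, h4⟩ := h
    refine (mem_moves.1 ho).ext (mem_moves.1 ho') h1 ?_ h2
    simp only [Move.snd, h2, h3, h4]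
  rw [Finset.sum_mul]
  calc _ ≤ ∑ x, g x := by
        refine sum_le_sum_of_injOn _ hinj (fun o ho => ?_) fun x => ?_
        · have h := mem_moves.1 ho
          have h1 : o.1.2 ∈ PS := Finset.mem_powersetCard.2 ⟨h.sub₂, h.card_s₂⟩
          have h2 : o.2.1.2 ∈ PT := Finset.mem_powersetCard.2 ⟨Finset.subset_univ _, h.card_t₂⟩
          simp only [hg, h1, h2, IsMove.mem_fst, if_true, one_mul]
          by_cases h0 : c o.fst = 0
          · simp [h0]
          · rw [mul_assoc, mul_left_comm (weight κ u S c)]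
            exact mul_le_mul_of_nonneg_left
              (weight_annihilate_create_le hκ hu hu1 hk h h0) (Nat.cast_nonneg _)
        · simp only [hg]
          refine mul_nonneg hw (mul_nonneg ?_ (mul_nonneg ?_ ?_)) <;> split_ifs
          all_goals first | exact hprod _ | positivity
    _ = weight κ u S c * (((2 * k + 1) * mass c) * (PS.card * ∑ T ∈ PT, ∏ v ∈ T, a v)) := by
        rw [← sum_mul_ite_mem_le hc]
        simp only [hg]
        rw [← Finset.mul_sum, sum_univ_prod_mul
          (fun x : Finset (Fin n) × Fin n => if x.2 ∈ x.1 then (c x.1 : ℝ) else 0)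
          (fun y : Finset (Fin n) × Finset (Fin n) =>
            (if y.1 ∈ PS then 1 else 0) * if y.2 ∈ PT then ∏ v ∈ y.2, a v else 0),
          sum_univ_prod_mul (fun T : Finset (Fin n) => if T ∈ PS then (1 : ℝ) else 0)
          (fun T : Finset (Fin n) => if T ∈ PT then ∏ v ∈ T, a v else 0),
          Fintype.sum_prod_type]
        simp
    _ ≤ weight κ u S c * (((2 * k + 1) * mass c) *
          ((S.card : ℝ) ^ k * (n * u + (S ∪ vertices c).card) ^ k)) := by
        have hc := card_powersetCard_le_pow S k
        have hT' := hT.trans (pow_le_pow_left₀ hA0 hA k)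
        have hT0 : 0 ≤ ∑ T ∈ PT, ∏ v ∈ T, a v := Finset.sum_nonneg fun T _ => hprod T
        gcongr
    _ = _ := by ring

/-- Both hyperedges come from `c`, and `t` is one of the `2k+1` vertices of the first. -/
theorem sum_mul_mul_le (hc : ∀ A, c A ≠ 0 → A.card = 2 * k + 1) :
    ∑ o ∈ moves k S, (c o.snd * c o.fst : ℝ) ≤ (2 * k + 1) * mass c * mass c := by
  calc _ ≤ ∑ x : (Finset (Fin n) × Fin n) × Finset (Fin n),
          (if x.1.2 ∈ x.1.1 then (c x.1.1 : ℝ) else 0) * c x.2 := by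
        refine sum_le_sum_of_injOn (fun o : Move n => ((o.fst, o.2.2), o.snd)) ?_ ?_ ?_
        · intro o ho o' ho' h
          simp only [Prod.mk.injEq] at h
          exact (mem_moves.1 ho).ext (mem_moves.1 ho') h.1.1 h.2 h.1.2
        · intro o _
          simp only [IsMove.mem_fst, if_true]
          rw [mul_comm]
        · intro x
          split_ifs <;> positivity
    _ = _ := by
        rw [← sum_mul_ite_mem_le hc, Fintype.sum_prod_type]
        simp only
        simp_rw [← Finset.mul_sum]
        rw [← Finset.sum_mul, Fintype.sum_prod_type]
        simp [mass]

theorem isPrivate_eq_of_mem {o : Move n} (h : IsPrivate c o) {v : Fin n}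
    (hv : v ∈ o.1.1 ∪ o.1.2 ∪ {o.2.2}) {A : Finset (Fin n)} (hA : c A ≠ 0) (hvA : v ∈ A) :
    A = o.fst ∨ A = o.snd := by
  by_contra! hne
  refine h v hv (mem_vertices.2 ⟨A, ?_, hvA⟩)
  simpa [Pi.single_eq_of_ne hne.1, Pi.single_eq_of_ne hne.2] using hA

-- Fix `v ∈ S₁ ⊆ S`. By privacy only the two hyperedges of the move contain `v`, and the second does
-- not, so `v` determines the first. Then `t` is one of its `2k+1` vertices, and privacy at `t`
-- determines the second.
open Classical in
theorem card_filter_isPrivate_le (hk : 1 ≤ k) (hc : ∀ A, c A ≠ 0 → A.card = 2 * k + 1) :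
    ((moves k S).filter fun o => c o.fst ≠ 0 ∧ c o.snd ≠ 0 ∧ IsPrivate c o).card ≤
      S.card * (2 * k + 1) := by
  set P := (moves k S).filter fun o => c o.fst ≠ 0 ∧ c o.snd ≠ 0 ∧ IsPrivate c o with hP
  have hsub : P ⊆ S.biUnion fun v => P.filter fun o => v ∈ o.1.1 := by
    intro o ho
    have h := mem_moves.1 (Finset.mem_filter.1 ho).1
    obtain ⟨v, hv⟩ := Finset.card_pos.1 (h.card_s₁.symm ▸ hk : 0 < o.1.1.card)
    exact Finset.mem_biUnion.2 ⟨v, h.sub₁ hv, Finset.mem_filter.2 ⟨ho, hv⟩⟩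
  refine (Finset.card_le_card hsub).trans (Finset.card_biUnion_le_card_mul _ _ _ fun v _ => ?_)
  rcases (P.filter fun o => v ∈ o.1.1).eq_empty_or_nonempty with he | ⟨o₀, ho₀⟩
  · simp [he]
  obtain ⟨hP₀, hv₀⟩ := Finset.mem_filter.1 ho₀
  obtain ⟨hm₀, h1₀, h2₀, hp₀⟩ := Finset.mem_filter.1 hP₀
  have hfst : ∀ o ∈ P.filter fun o => v ∈ o.1.1, o.fst = o₀.fst := by
    intro o ho
    obtain ⟨hoP, hv⟩ := Finset.mem_filter.1 ho
    obtain ⟨hm, h1, h2, hp⟩ := Finset.mem_filter.1 hoP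
    have hvo : v ∈ o.fst := by simp [Move.fst, hv]
    exact (isPrivate_eq_of_mem hp₀ (by simp [hv₀]) h1 hvo).resolve_right
      fun h => (mem_moves.1 hm₀).notMem_snd hv₀ (h ▸ hvo)
  rw [← hc _ h1₀]
  refine Finset.card_le_card_of_injOn (fun o => o.2.2) (fun o ho => ?_) ?_
  · exact hfst o ho ▸ IsMove.mem_fst o
  · intro o ho o' ho' ht
    have hoP := (Finset.mem_filter.1 ho).1
    have hoP' := (Finset.mem_filter.1 ho').1
    obtain ⟨hm, h1, h2, hp⟩ := Finset.mem_filter.1 hoP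
    obtain ⟨hm', h1', h2', hp'⟩ := Finset.mem_filter.1 hoP'
    have hf : o.fst = o'.fst := (hfst o ho).trans (hfst o' ho').symm
    have ht' : o.2.2 = o'.2.2 := ht
    refine (mem_moves.1 hm).ext (mem_moves.1 hm') hf ?_ ht'
    have ht2 : o.2.2 ∈ o'.snd := ht' ▸ IsMove.mem_snd o'
    have := isPrivate_eq_of_mem hp (v := o.2.2) (by simp) h2' ht2
    exact (this.resolve_left fun h => (mem_moves.1 hm').fst_ne_snd hk (hf ▸ h.symm)).symm

open Classical in
theorem sum_weight_annihilate_annihilate_le (hκ : 0 < κ) (hu : 0 < u) (hu1 : u ≤ 1) (hk : 1 ≤ k)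
    (hc : ∀ A, c A ≠ 0 → A.card = 2 * k + 1) :
    (∑ o ∈ moves k S, c o.snd * c o.fst *
        weight κ u (o.target S) (c - Pi.single o.snd 1 - Pi.single o.fst 1)) *
          (κ ^ 2 * u ^ (2 * k + 1)) ≤
      (2 * k + 1) * (mass c * mass c * u + S.card) * weight κ u S c := by
  have hw := weight_nonneg hκ hu S c
  set P := (moves k S).filter fun o => c o.fst ≠ 0 ∧ c o.snd ≠ 0 ∧ IsPrivate c o with hP
  have hterm : ∀ o ∈ moves k S, c o.snd * c o.fst *
        weight κ u (o.target S) (c - Pi.single o.snd 1 - Pi.single o.fst 1) *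
          (κ ^ 2 * u ^ (2 * k + 1)) ≤
      weight κ u S c * (u * (c o.snd * c o.fst) +
        if c o.fst ≠ 0 ∧ c o.snd ≠ 0 ∧ IsPrivate c o then 1 else 0) := by
    intro o ho
    have h := mem_moves.1 ho
    by_cases h1 : c o.fst = 0
    · simp [h1]
    by_cases h2 : c o.snd = 0
    · simp [h2]
    have hle := mul_le_mul_of_nonneg_left
      (weight_annihilate_annihilate_le hκ hu hu1 hk h h1 h2)
      (by positivity : (0 : ℝ) ≤ c o.snd * c o.fst)
    refine (mul_assoc _ _ _).trans_le (hle.trans_eq ?_)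
    -- Privacy forces both multiplicities to be one, as a second copy would still cover `S₁` or `t`.
    -- The coefficient of a private move is therefore `1`.
    by_cases hp : IsPrivate c o
    · have hne := h.fst_ne_snd hk
      obtain ⟨v, hv⟩ := Finset.card_pos.1 (h.card_s₁.symm ▸ hk : 0 < o.1.1.card)
      have hone₁ : c o.fst = 1 := by
        by_contra hone
        refine hp v (by simp [hv]) (mem_vertices.2 ⟨o.fst, ?_, by simp [Move.fst, hv]⟩)
        simp only [Pi.sub_apply, Pi.single_eq_same, Pi.single_eq_of_ne hne]
        omega
      have hone₂ : c o.snd = 1 := by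
        by_contra hone
        refine hp o.2.2 (by simp) (mem_vertices.2 ⟨o.snd, ?_, IsMove.mem_snd o⟩)
        simp only [Pi.sub_apply, Pi.single_eq_same, Pi.single_eq_of_ne hne.symm]
        omega
      simp [hp, hone₁, hone₂]
    · simp [hp]
      ring
  rw [Finset.sum_mul]
  refine (Finset.sum_le_sum hterm).trans ?_
  rw [← Finset.mul_sum, Finset.sum_add_distrib, ← Finset.mul_sum, Finset.sum_boole]
  have h1 := sum_mul_mul_le (S := S) hc
  have h2 : ((moves k S).filter fun o => c o.fst ≠ 0 ∧ c o.snd ≠ 0 ∧ IsPrivate c o).card ≤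
      (S.card : ℝ) * (2 * k + 1) := by exact_mod_cast card_filter_isPrivate_le hk hc
  calc _ ≤ weight κ u S c * (u * ((2 * k + 1) * mass c * mass c) + S.card * (2 * k + 1)) := by
        gcongr
    _ = _ := by ring

end Sums

/-- Exchanging the two hyperedges of each move reduces the second mixed case to the first. Truncated
subtraction commutes with the addition because the hyperedges differ. -/
theorem sum_weight_create_annihilate_eq {n k : ℕ} {S : Finset (Fin n)} {c : Finset (Fin n) → ℕ}
    {κ u : ℝ} (hk : 1 ≤ k) :
    ∑ o ∈ moves k S,
        c o.snd * weight κ u (o.target S) (c - Pi.single o.snd 1 + Pi.single o.fst 1) =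
      ∑ o ∈ moves k S,
        c o.fst * weight κ u (o.target S) (c + Pi.single o.snd 1 - Pi.single o.fst 1) := by
  rw [← sum_moves_swap]
  refine Finset.sum_congr rfl fun o ho => ?_
  have hne := (mem_moves.1 ho).fst_ne_snd hk
  have h1 : o.swap.target S = o.target S := by
    simp [Move.target, Move.swap, Finset.union_comm]
  have h2 : o.swap.snd = o.fst := rfl
  have h3 : o.swap.fst = o.snd := rfl
  rw [h1, h2, h3]
  congr 2
  funext A
  by_cases hA : A = o.fst
  · subst hA; simp [Pi.single_eq_of_ne hne]
  · simp [Pi.single_eq_of_ne hA]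

/-- The constant in the bound on one step of the walk. -/
noncomputable def stepConst (k : ℕ) : ℝ :=
  2 ^ (2 * k + 1) + 2 * ((2 * k + 1) * 2 ^ k) + 2 * (2 * k + 1)

theorem stepConst_pos (k : ℕ) : 0 < stepConst k := by unfold stepConst; positivity

/-- The supersolution inequality. `hκs` balances double creation against double annihilation, `hL`
pays for the choice of hyperedge in the mixed cases, `hLu` pays for non-private pairs, and `hn`
makes fresh vertices dominate those already present. -/
theorem sum_moves_le {n k : ℕ} {S : Finset (Fin n)} {c : Finset (Fin n) → ℕ}
    {κ u s L : ℝ} (hκ : 0 < κ) (hu : 0 < u) (hu1 : u ≤ 1) (hk : 1 ≤ k)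
    (hc : ∀ A, c A ≠ 0 → A.card = 2 * k + 1) (hs : 0 < s) (hs2 : s ^ 2 = n * S.card)
    (hS : 1 ≤ (S.card : ℝ))
    (hκs : κ ^ 2 * u ^ (2 * k + 1) * s ^ (2 * k + 1) = S.card)
    (hm : mass c ≤ L) (hL : L ≤ s) (hLu : L * L * u ≤ 1)
    (hn : S.card + (2 * k + 1) * L ≤ n * u) :
    ∑ o ∈ moves k S,
      (weight κ u (o.target S) (c + Pi.single o.snd 1 + Pi.single o.fst 1) +
        c o.fst * weight κ u (o.target S) (c + Pi.single o.snd 1 - Pi.single o.fst 1) +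
        c o.snd * weight κ u (o.target S) (c - Pi.single o.snd 1 + Pi.single o.fst 1) +
        c o.snd * c o.fst *
          weight κ u (o.target S) (c - Pi.single o.snd 1 - Pi.single o.fst 1)) ≤
      stepConst k * s ^ (2 * k + 1) * weight κ u S c := by
  have hw := weight_nonneg hκ hu S c
  have hL0 : 0 ≤ L := (Nat.cast_nonneg _).trans hm
  have hX : n * u + (S ∪ vertices c).card ≤ 2 * (n * u) := by
    have h1 : ((S ∪ vertices c).card : ℝ) ≤ S.card + (vertices c).card := by
      exact_mod_cast Finset.card_union_le _ _
    have h2 : ((vertices c).card : ℝ) ≤ (2 * k + 1) * mass c := by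
      exact_mod_cast card_vertices_le hc
    have h3 : (2 * k + 1) * (mass c : ℝ) ≤ (2 * k + 1) * L := by gcongr
    linarith
  have hS0 : (S.card : ℝ) ≠ 0 := by positivity
  have hsp : 0 < s ^ (2 * k + 1) := by positivity
  have hns : (n * S.card : ℝ) ^ k = s ^ (2 * k) := by rw [← hs2, pow_mul]
  have h1 : ∑ o ∈ moves k S,
      weight κ u (o.target S) (c + Pi.single o.snd 1 + Pi.single o.fst 1) ≤
        2 ^ (2 * k + 1) * s ^ (2 * k + 1) * weight κ u S c := by
    refine (sum_weight_create_create_le hκ hu hu1).trans ?_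
    refine mul_le_mul_of_nonneg_right ?_ hw
    calc κ ^ 2 * (S.card : ℝ) ^ (2 * k) * (n * u + (S ∪ vertices c).card) ^ (2 * k + 1)
        ≤ κ ^ 2 * (S.card : ℝ) ^ (2 * k) * (2 * (n * u)) ^ (2 * k + 1) := by gcongr
      _ = 2 ^ (2 * k + 1) * s ^ (2 * k + 1) := by
        refine mul_right_cancel₀ hsp.ne' ?_
        calc _ = 2 ^ (2 * k + 1) * (κ ^ 2 * u ^ (2 * k + 1) * s ^ (2 * k + 1)) *
              ((S.card : ℝ) ^ (2 * k) * n ^ (2 * k + 1)) := by rw [mul_pow, mul_pow]; ring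
          _ = 2 ^ (2 * k + 1) * (n * S.card) ^ (2 * k + 1) := by rw [hκs, mul_pow]; ring
          _ = _ := by rw [← hs2]; ring
  have h2 : ∑ o ∈ moves k S,
      c o.fst * weight κ u (o.target S) (c + Pi.single o.snd 1 - Pi.single o.fst 1) ≤
        (2 * k + 1) * 2 ^ k * s ^ (2 * k + 1) * weight κ u S c := by
    refine le_of_mul_le_mul_right
      ((sum_weight_annihilate_create_le hκ hu hu1 hk hc).trans ?_) (pow_pos hu k)
    calc _ ≤ (2 * k + 1) * s * (S.card : ℝ) ^ k * (2 * (n * u)) ^ k * weight κ u S c := by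
          gcongr
          exact hm.trans hL
      _ = (2 * k + 1) * 2 ^ k * (s * (n * S.card : ℝ) ^ k) * weight κ u S c * u ^ k := by
          rw [mul_pow, mul_pow, mul_pow]; ring
      _ = _ := by rw [hns]; ring
  have h4 : ∑ o ∈ moves k S, c o.snd * c o.fst *
      weight κ u (o.target S) (c - Pi.single o.snd 1 - Pi.single o.fst 1) ≤
        2 * (2 * k + 1) * s ^ (2 * k + 1) * weight κ u S c := by
    refine le_of_mul_le_mul_right
      ((sum_weight_annihilate_annihilate_le hκ hu hu1 hk hc).trans ?_)
      (by positivity : 0 < κ ^ 2 * u ^ (2 * k + 1))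
    have hmm : mass c * mass c * u ≤ (S.card : ℝ) := by
      refine le_trans ?_ (hLu.trans hS)
      gcongr
    calc _ ≤ (2 * k + 1) * (S.card + S.card : ℝ) * weight κ u S c := by gcongr
      _ = 2 * (2 * k + 1) * (κ ^ 2 * u ^ (2 * k + 1) * s ^ (2 * k + 1)) * weight κ u S c := by
        rw [hκs]; ring
      _ = _ := by ring
  rw [Finset.sum_add_distrib, Finset.sum_add_distrib, Finset.sum_add_distrib,
    sum_weight_create_annihilate_eq hk]
  unfold stepConst
  linarith

/-! ### The Kikuchi matrix as a sum over moves -/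

/-- The summands of the entry `(S, R)` of the Kikuchi matrix. -/
def movesBetween {n : ℕ} (r : ℕ) (S R : Finset (Fin n)) : Finset (Move n) :=
  if (symmDiff S R).card = 2 * r - 2 then
    equalPartitions (S \ R) ×ˢ (equalPartitions (R \ S) ×ˢ (S ∪ R)ᶜ) else ∅

theorem kikuchiMatrix_apply {n r ℓ : ℕ} (G : SymTensor n r) (S R : Subsets n ℓ) :
    kikuchiMatrix ℓ G S R =
      ∑ o ∈ movesBetween r S.1 R.1, G.entry o.fst * G.entry o.snd := by
  unfold movesBetween
  rw [kikuchiMatrix, Matrix.of_apply]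
  split_ifs
  · rw [Finset.sum_comm, Finset.sum_product]
    refine Finset.sum_congr rfl fun p _ => ?_
    rw [Finset.sum_comm, Finset.sum_product]
    rfl
  · simp

theorem kikuchiMatrix_isSymm {n r ℓ : ℕ} (G : SymTensor n r) : (kikuchiMatrix ℓ G).IsSymm := by
  refine Matrix.IsSymm.ext fun S R => ?_
  simp only [kikuchiMatrix, Matrix.of_apply]
  rw [symmDiff_comm, Finset.union_comm]
  congr 1
  refine Finset.sum_congr rfl fun t _ => ?_
  rw [Finset.sum_comm]
  refine Finset.sum_congr rfl fun p _ => Finset.sum_congr rfl fun p' _ => ?_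
  rw [Finset.union_comm p.1, Finset.union_comm p.2]

theorem isMove_of_mem_movesBetween {n k ℓ : ℕ} {S R : Subsets n ℓ} {o : Move n}
    (ho : o ∈ movesBetween (2 * k + 1) S.1 R.1) : IsMove k S.1 o ∧ o.target S.1 = R.1 := by
  unfold movesBetween at ho
  split_ifs at ho with hcard
  swap
  · simp at ho
  simp only [Finset.mem_product, equalPartitions, Finset.mem_filter, Finset.mem_powerset] at ho
  obtain ⟨⟨⟨h1, h2⟩, hd, hu, hc⟩, ⟨⟨h1', h2'⟩, hd', hu', hc'⟩, ht⟩ := ho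
  have hdis : Disjoint (S.1 \ R.1) (R.1 \ S.1) := disjoint_sdiff_sdiff
  have hs : (S.1 \ R.1).card + (R.1 \ S.1).card = 2 * (2 * k + 1) - 2 := by
    rw [← hcard, ← Finset.card_union_of_disjoint hdis]; rfl
  have he : (S.1 \ R.1).card = (R.1 \ S.1).card := Finset.card_sdiff_comm (S.2.trans R.2.symm)
  have hcu := Finset.card_union_of_disjoint hd
  have hcu' := Finset.card_union_of_disjoint hd'
  rw [hu] at hcu
  rw [hu'] at hcu'
  simp only [Finset.mem_compl, Finset.mem_union, not_or] at ht
  refine ⟨⟨h1.trans Finset.sdiff_subset, h2.trans Finset.sdiff_subset, by omega, by omega,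
    by omega, by omega, hd, hd', Finset.disjoint_of_subset_left h1' Finset.sdiff_disjoint,
    Finset.disjoint_of_subset_left h2' Finset.sdiff_disjoint, ht.1,
    fun h => ht.2 (Finset.mem_sdiff.1 (h1' h)).1, fun h => ht.2 (Finset.mem_sdiff.1 (h2' h)).1⟩, ?_⟩
  rw [Move.target, hu, hu']
  ext v
  simp only [Finset.mem_union, Finset.mem_sdiff]
  tauto

/-- The target of a move is `R`, so distinct `R` have disjoint sets of moves. -/
theorem sum_movesBetween_le {n k ℓ : ℕ} (S : Subsets n ℓ) {F : Move n → ℝ} (hF : ∀ o, 0 ≤ F o) :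
    ∑ R : Subsets n ℓ, ∑ o ∈ movesBetween (2 * k + 1) S.1 R.1, F o ≤ ∑ o ∈ moves k S.1, F o := by
  rw [← Finset.sum_biUnion]
  · refine Finset.sum_le_sum_of_subset_of_nonneg (fun o ho => ?_) fun o _ _ => hF o
    obtain ⟨R, -, hR⟩ := Finset.mem_biUnion.1 ho
    exact mem_moves.2 (isMove_of_mem_movesBetween hR).1
  · intro R _ R' _ hne
    refine Finset.disjoint_left.2 fun o h h' => hne (Subtype.ext ?_)
    rw [← (isMove_of_mem_movesBetween h).2, ← (isMove_of_mem_movesBetween h').2]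

/-! ### Moment recursion and trace bound -/

theorem isPoly_kikuchiMatrix_pow {n r ℓ : ℕ} (j : ℕ) (S R : Subsets n ℓ) :
    IsPoly (fun G : SymTensor n r => (kikuchiMatrix ℓ G ^ j) S R) := by
  induction j generalizing R with
  | zero => simpa using IsPoly.const _
  | succ j ih =>
    simp only [pow_succ, Matrix.mul_apply]
    refine IsPoly.sum _ fun Q _ => (ih Q).mul ?_
    simp only [kikuchiMatrix_apply]
    exact IsPoly.sum _ fun o _ => (IsPoly.entry _).mul (IsPoly.entry _)

theorem abs_integral_linear_combination_le {α : Type*} [MeasurableSpace α] {μ : Measure α}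
    {g₁ g₂ g₃ g₄ : α → ℝ} (h₁ : Integrable g₁ μ) (h₂ : Integrable g₂ μ) (h₃ : Integrable g₃ μ)
    (h₄ : Integrable g₄ μ) {a₂ a₃ a₄ : ℝ} (ha₂ : 0 ≤ a₂) (ha₃ : 0 ≤ a₃) (ha₄ : 0 ≤ a₄) :
    |∫ x, g₁ x + a₂ * g₂ x + a₃ * g₃ x + a₄ * g₄ x ∂μ| ≤
      |∫ x, g₁ x ∂μ| + a₂ * |∫ x, g₂ x ∂μ| + a₃ * |∫ x, g₃ x ∂μ| + a₄ * |∫ x, g₄ x ∂μ| := by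
  have h12 : Integrable (fun x => g₁ x + a₂ * g₂ x) μ := h₁.add (h₂.const_mul _)
  have h123 : Integrable (fun x => g₁ x + a₂ * g₂ x + a₃ * g₃ x) μ := h12.add (h₃.const_mul _)
  rw [integral_add h123 (h₄.const_mul _), integral_add h12 (h₃.const_mul _),
    integral_add h₁ (h₂.const_mul _), integral_const_mul, integral_const_mul, integral_const_mul]
  refine (abs_add_le _ _).trans (add_le_add ((abs_add_le _ _).trans
    (add_le_add ((abs_add_le _ _).trans (add_le_add le_rfl ?_)) ?_)) ?_)
  all_goals rw [abs_mul, abs_of_nonneg (by assumption)]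

theorem abs_integral_mul_le {n r : ℕ} {f : SymTensor n r → ℝ} (hf : IsPoly f)
    (c : Finset (Fin n) → ℕ) {e e' : Finset (Fin n)} (he : e.card = r) (he' : e'.card = r)
    (hne : e ≠ e') :
    |∫ G, f G * (G.entry e * G.entry e') * hermiteProd c G ∂(gaussianTensor n r)| ≤
      |∫ G, f G * hermiteProd (c + Pi.single e' 1 + Pi.single e 1) G ∂(gaussianTensor n r)| +
      c e * |∫ G, f G * hermiteProd (c + Pi.single e' 1 - Pi.single e 1) G
        ∂(gaussianTensor n r)| +
      c e' * |∫ G, f G * hermiteProd (c - Pi.single e' 1 + Pi.single e 1) G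
        ∂(gaussianTensor n r)| +
      c e' * c e * |∫ G, f G * hermiteProd (c - Pi.single e' 1 - Pi.single e 1) G
        ∂(gaussianTensor n r)| := by
  have hi : ∀ c', Integrable (fun G => f G * hermiteProd c' G) (gaussianTensor n r) :=
    fun c' => (hf.mul (isPoly_hermiteProd c')).integrable
  have hexp : ∀ G, f G * (G.entry e * G.entry e') * hermiteProd c G =
      f G * hermiteProd (c + Pi.single e' 1 + Pi.single e 1) G +
      c e * (f G * hermiteProd (c + Pi.single e' 1 - Pi.single e 1) G) +
      c e' * (f G * hermiteProd (c - Pi.single e' 1 + Pi.single e 1) G) +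
      c e' * c e * (f G * hermiteProd (c - Pi.single e' 1 - Pi.single e 1) G) := by
    intro G
    rw [mul_assoc, entry_mul_entry_mul_hermiteProd c he he' hne]
    ring
  simp only [hexp]
  exact abs_integral_linear_combination_le (hi _) (hi _) (hi _) (hi _) (Nat.cast_nonneg _)
    (Nat.cast_nonneg _) (by positivity)

/-- Each step peels off the last matrix factor and applies `sum_moves_le`. It adds at most two
hyperedges, so the budget `mass c + 2 * j ≤ L` is preserved. The factor `u⁻¹ ^ ℓ` normalises the
weight of `(S, 0)` to one, which is the value needed at `j = 0`. -/
theorem abs_integral_kikuchiMatrix_pow_mul_le {n k ℓ : ℕ} (hk : 1 ≤ k) (hℓ : 1 ≤ ℓ)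
    {κ u s : ℝ} {L : ℕ} (hκ : 0 < κ) (hu : 0 < u) (hu1 : u ≤ 1)
    (hs : 0 < s) (hs2 : s ^ 2 = n * ℓ)
    (hκs : κ ^ 2 * u ^ (2 * k + 1) * s ^ (2 * k + 1) = ℓ)
    (hL : L ≤ s) (hLu : L * L * u ≤ 1) (hn : ℓ + (2 * k + 1) * L ≤ n * u)
    (j : ℕ) (S₀ S : Subsets n ℓ) (c : Finset (Fin n) → ℕ)
    (hc : ∀ A, c A ≠ 0 → A.card = 2 * k + 1) (hm : mass c + 2 * j ≤ L) :
    |∫ G, (kikuchiMatrix ℓ G ^ j) S₀ S * hermiteProd c G ∂(gaussianTensor n (2 * k + 1))| ≤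
      (stepConst k * s ^ (2 * k + 1)) ^ j * (u⁻¹ ^ ℓ * weight κ u S.1 c) := by
  induction j generalizing S c with
  | zero =>
    have hw := weight_nonneg hκ hu S.1 c
    have hr : 0 ≤ u⁻¹ ^ ℓ * weight κ u S.1 c := by positivity
    simp only [pow_zero, one_mul, Matrix.one_apply, ite_mul, zero_mul]
    split_ifs with h
    · rw [integral_hermiteProd hc]
      split_ifs with h0
      · subst h0
        have hv : vertices (0 : Finset (Fin n) → ℕ) = ∅ := by simp [vertices]
        have hm0 : mass (0 : Finset (Fin n) → ℕ) = 0 := by simp [mass]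
        rw [weight, hv, hm0, Finset.union_empty, S.2, pow_zero, one_mul, ← mul_pow,
          inv_mul_cancel₀ hu.ne', one_pow, abs_one]
      · simpa using hr
    · simpa using hr
  | succ j ih =>
    set Λ := stepConst k * s ^ (2 * k + 1) with hΛ
    have hΛ0 : 0 < Λ := mul_pos (stepConst_pos k) (by positivity)
    set D := Λ ^ j * u⁻¹ ^ ℓ with hD
    have hD0 : 0 < D := by positivity
    have hexp : ∀ G : SymTensor n (2 * k + 1),
        (kikuchiMatrix ℓ G ^ (j + 1)) S₀ S * hermiteProd c G =
        ∑ R : Subsets n ℓ, ∑ o ∈ movesBetween (2 * k + 1) S.1 R.1,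
          (kikuchiMatrix ℓ G ^ j) S₀ R * (G.entry o.fst * G.entry o.snd) * hermiteProd c G := by
      intro G
      rw [pow_succ, Matrix.mul_apply, Finset.sum_mul]
      refine Finset.sum_congr rfl fun R _ => ?_
      -- Symmetry lets the last factor be read as a move starting from `S`.
      rw [(kikuchiMatrix_isSymm G).apply S R, kikuchiMatrix_apply, Finset.mul_sum, Finset.sum_mul]
    have hint : ∀ R : Subsets n ℓ, ∀ o : Move n, Integrable (fun G : SymTensor n (2 * k + 1) =>
        (kikuchiMatrix ℓ G ^ j) S₀ R * (G.entry o.fst * G.entry o.snd) * hermiteProd c G)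
          (gaussianTensor n (2 * k + 1)) := fun R o =>
      (((isPoly_kikuchiMatrix_pow j S₀ R).mul ((IsPoly.entry _).mul (IsPoly.entry _))).mul
        (isPoly_hermiteProd c)).integrable
    set F : Move n → ℝ := fun o => D *
      (weight κ u (o.target S.1) (c + Pi.single o.snd 1 + Pi.single o.fst 1) +
        c o.fst * weight κ u (o.target S.1) (c + Pi.single o.snd 1 - Pi.single o.fst 1) +
        c o.snd * weight κ u (o.target S.1) (c - Pi.single o.snd 1 + Pi.single o.fst 1) +
        c o.snd * c o.fst *
          weight κ u (o.target S.1) (c - Pi.single o.snd 1 - Pi.single o.fst 1)) with hF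
    have hF0 : ∀ o, 0 ≤ F o := by
      intro o
      have hw := fun c' => weight_nonneg hκ hu (o.target S.1) c'
      simp only [hF]
      have h1 := hw (c + Pi.single o.snd 1 + Pi.single o.fst 1)
      have h2 := hw (c + Pi.single o.snd 1 - Pi.single o.fst 1)
      have h3 := hw (c - Pi.single o.snd 1 + Pi.single o.fst 1)
      have h4 := hw (c - Pi.single o.snd 1 - Pi.single o.fst 1)
      positivity
    have hterm : ∀ R : Subsets n ℓ, ∀ o ∈ movesBetween (2 * k + 1) S.1 R.1,
        |∫ G : SymTensor n (2 * k + 1), (kikuchiMatrix ℓ G ^ j) S₀ R *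
          (G.entry o.fst * G.entry o.snd) * hermiteProd c G
            ∂(gaussianTensor n (2 * k + 1))| ≤ F o := by
      intro R o ho
      obtain ⟨hmove, htar⟩ := isMove_of_mem_movesBetween ho
      have hne := hmove.fst_ne_snd hk
      refine (abs_integral_mul_le (isPoly_kikuchiMatrix_pow j S₀ R) c hmove.card_fst
        hmove.card_snd hne).trans ?_
      have ih' : ∀ c' : Finset (Fin n) → ℕ, (∀ A, c' A ≤ c A + (Pi.single o.snd 1 : _ → ℕ) A +
          (Pi.single o.fst 1 : _ → ℕ) A) → mass c' ≤ mass c + 2 →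
          |∫ G, (kikuchiMatrix ℓ G ^ j) S₀ R * hermiteProd c' G
            ∂(gaussianTensor n (2 * k + 1))| ≤ D * weight κ u (o.target S.1) c' := by
        intro c' hle hmass
        rw [htar, hD, mul_assoc]
        refine ih R c' (fun A hA => ?_) (by omega)
        by_cases h1 : A = o.fst
        · exact h1 ▸ hmove.card_fst
        by_cases h2 : A = o.snd
        · exact h2 ▸ hmove.card_snd
        have := hle A
        rw [Pi.single_eq_of_ne h1, Pi.single_eq_of_ne h2] at this
        exact hc A (by omega)
      have hmono : ∀ {a b : Finset (Fin n) → ℕ}, a ≤ b → mass a ≤ mass b :=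
        fun h => Finset.sum_le_sum fun A _ => h A
      have hmass : mass (c + Pi.single o.snd 1 + Pi.single o.fst 1) = mass c + 2 := by
        rw [mass_add_single, mass_add_single]
      have hall : ∀ c' : Finset (Fin n) → ℕ, c' ≤ c + Pi.single o.snd 1 + Pi.single o.fst 1 →
          |∫ G, (kikuchiMatrix ℓ G ^ j) S₀ R * hermiteProd c' G
            ∂(gaussianTensor n (2 * k + 1))| ≤ D * weight κ u (o.target S.1) c' :=
        fun c' h => ih' c' h ((hmono h).trans_eq hmass)
      have b1 := hall (c + Pi.single o.snd 1 + Pi.single o.fst 1) le_rfl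
      have b2 := hall (c + Pi.single o.snd 1 - Pi.single o.fst 1)
        fun A => by simp only [Pi.add_apply, Pi.sub_apply]; omega
      have b3 := hall (c - Pi.single o.snd 1 + Pi.single o.fst 1)
        fun A => by simp only [Pi.add_apply, Pi.sub_apply]; omega
      have b4 := hall (c - Pi.single o.snd 1 - Pi.single o.fst 1)
        fun A => by simp only [Pi.add_apply, Pi.sub_apply]; omega
      calc _ ≤ D * weight κ u (o.target S.1) (c + Pi.single o.snd 1 + Pi.single o.fst 1) +
            c o.fst * (D * weight κ u (o.target S.1) (c + Pi.single o.snd 1 - Pi.single o.fst 1)) +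
            c o.snd * (D * weight κ u (o.target S.1) (c - Pi.single o.snd 1 + Pi.single o.fst 1)) +
            c o.snd * c o.fst *
              (D * weight κ u (o.target S.1) (c - Pi.single o.snd 1 - Pi.single o.fst 1)) := by
            gcongr
        _ = F o := by simp only [hF]; ring
    simp only [hexp]
    rw [integral_finsetSum _ fun R _ => integrable_finsetSum _ fun o _ => hint R o]
    refine (Finset.abs_sum_le_sum_abs _ _).trans ?_
    calc _ ≤ ∑ R : Subsets n ℓ, ∑ o ∈ movesBetween (2 * k + 1) S.1 R.1, F o := by
          refine Finset.sum_le_sum fun R _ => ?_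
          rw [integral_finsetSum _ fun o _ => hint R o]
          exact (Finset.abs_sum_le_sum_abs _ _).trans (Finset.sum_le_sum (hterm R))
      _ ≤ ∑ o ∈ moves k S.1, F o := sum_movesBetween_le S hF0
      _ ≤ D * (Λ * weight κ u S.1 c) := by
          simp only [hF]
          rw [← Finset.mul_sum]
          refine mul_le_mul_of_nonneg_left ?_ hD0.le
          refine sum_moves_le hκ hu hu1 hk hc hs (by rw [S.2]; exact hs2)
            (by rw [S.2]; exact_mod_cast hℓ) (by rw [S.2]; exact hκs) (L := L) ?_ hL hLu
            (by rw [S.2]; exact hn)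
          exact_mod_cast (by omega : mass c ≤ L)
      _ = _ := by rw [hD, pow_succ]; ring

theorem integral_trace_kikuchiMatrix_pow_le {n k ℓ : ℕ} (hk : 1 ≤ k) (hℓ : 1 ≤ ℓ)
    {κ u s : ℝ} {j : ℕ} (hκ : 0 < κ) (hu : 0 < u) (hu1 : u ≤ 1)
    (hs : 0 < s) (hs2 : s ^ 2 = n * ℓ)
    (hκs : κ ^ 2 * u ^ (2 * k + 1) * s ^ (2 * k + 1) = ℓ)
    (hL : ((2 * j : ℕ) : ℝ) ≤ s) (hLu : ((2 * j : ℕ) : ℝ) * (2 * j : ℕ) * u ≤ 1)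
    (hn : ℓ + (2 * k + 1) * ((2 * j : ℕ) : ℝ) ≤ n * u) :
    ∫ G, (kikuchiMatrix ℓ G ^ j).trace ∂(gaussianTensor n (2 * k + 1)) ≤
      n.choose ℓ * (stepConst k * s ^ (2 * k + 1)) ^ j := by
  have hH : ∀ G : SymTensor n (2 * k + 1), hermiteProd 0 G = 1 := fun G => by
    simp [hermiteProd, hermiteFun_zero]
  simp only [Matrix.trace, Matrix.diag]
  rw [integral_finsetSum _ fun S _ => (isPoly_kikuchiMatrix_pow j S S).integrable]
  calc _ ≤ ∑ _S : Subsets n ℓ, (stepConst k * s ^ (2 * k + 1)) ^ j := by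
        refine Finset.sum_le_sum fun S _ => ?_
        have h := abs_integral_kikuchiMatrix_pow_mul_le hk hℓ hκ hu hu1 hs hs2 hκs hL hLu hn j S S
          0 (by simp) (by simp [mass])
        simp only [hH, mul_one] at h
        refine (le_abs_self _).trans (h.trans_eq ?_)
        have hv : vertices (0 : Finset (Fin n) → ℕ) = ∅ := by simp [vertices]
        have hm0 : mass (0 : Finset (Fin n) → ℕ) = 0 := by simp [mass]
        rw [weight, hv, hm0, Finset.union_empty, S.2, pow_zero, one_mul, ← mul_pow,
          inv_mul_cancel₀ hu.ne', one_pow, mul_one]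
    _ = _ := by
        rw [Finset.sum_const, nsmul_eq_mul, Finset.card_univ, Fintype.card_finset_len,
          Fintype.card_fin]

/-! ### Choice of parameters -/

/-- The spectral norm bound for one pair `(n, ℓ)`. -/
theorem measure_spectralNorm_kikuchiMatrix_le {n k ℓ m : ℕ} (hk : 1 ≤ k) (hℓ : 1 ≤ ℓ)
    (hℓm : ℓ ≤ 4 * 2 ^ m) (hn : (2 * k + 2) * (4 * 2 ^ m) ^ 3 ≤ n) :
    1 - (n.choose ℓ : ℝ) / 2 ^ (2 * 2 ^ m) ≤ (gaussianTensor n (2 * k + 1)).real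
      {G | spectralNorm (kikuchiMatrix ℓ G) ≤
        2 * (stepConst k * √((n : ℝ) * ℓ) ^ (2 * k + 1))} := by
  -- The moment has order `2 * 2 ^ m`, and each factor can create two hyperedges, so `L` bounds the
  -- mass throughout.
  set L : ℕ := 4 * 2 ^ m with hLdef
  have hL1 : 1 ≤ L := by have := Nat.one_le_two_pow (n := m); omega
  have hL1' : (1 : ℝ) ≤ L := by exact_mod_cast hL1
  have hn' : (2 * k + 2) * (L : ℝ) ^ 3 ≤ n := by exact_mod_cast hn
  have hℓ' : (1 : ℝ) ≤ ℓ := by exact_mod_cast hℓ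
  have hℓL : (ℓ : ℝ) ≤ L := by exact_mod_cast hℓm
  have hn2 : (L : ℝ) ^ 2 ≤ n := by
    refine le_trans ?_ hn'
    have : (L : ℝ) ^ 2 ≤ L ^ 3 := pow_le_pow_right₀ hL1' (by norm_num)
    have h0 : (0 : ℝ) ≤ k := Nat.cast_nonneg k
    nlinarith [pow_nonneg (zero_le_one.trans hL1') 3]
  have hn1 : (0 : ℝ) < n := lt_of_lt_of_le (by positivity) hn2
  set s := √((n : ℝ) * ℓ) with hs
  have hs0 : 0 < s := Real.sqrt_pos.2 (by positivity)
  have hs2 : s ^ 2 = n * ℓ := Real.sq_sqrt (by positivity)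
  -- The largest `u` with `L * L * u ≤ 1`. The requirement `ℓ + (2k+1)L ≤ nu` then follows from
  -- `(2k+2)L³ ≤ n`.
  set u : ℝ := ((L : ℝ) ^ 2)⁻¹ with hu
  have hu0 : 0 < u := by positivity
  have hu1 : u ≤ 1 := inv_le_one_of_one_le₀ (one_le_pow₀ hL1')
  set κ := √(ℓ / (u ^ (2 * k + 1) * s ^ (2 * k + 1))) with hκ
  have hκ0 : 0 < κ := Real.sqrt_pos.2 (by positivity)
  have hκs : κ ^ 2 * u ^ (2 * k + 1) * s ^ (2 * k + 1) = ℓ := by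
    rw [hκ, Real.sq_sqrt (by positivity)]
    field_simp
  have hj : 2 * (2 * 2 ^ m) = L := by omega
  refine measure_spectralNorm_le kikuchiMatrix_isSymm m ?_ ?_ ?_
  · exact (IsPoly.sum _ fun S _ => isPoly_kikuchiMatrix_pow _ S S).integrable
  · exact mul_pos (stepConst_pos k) (by positivity)
  · refine integral_trace_kikuchiMatrix_pow_le hk hℓ hκ0 hu0 hu1 hs0 hs2 hκs ?_ ?_ ?_
    · rw [hj]
      refine Real.le_sqrt_of_sq_le (hn2.trans ?_)
      nlinarith
    · rw [hj, ← pow_two, hu, mul_inv_cancel₀ (by positivity)]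
    · rw [hj, hu, ← div_eq_mul_inv, le_div_iff₀ (by positivity)]
      calc (ℓ + (2 * k + 1) * (L : ℝ)) * L ^ 2 ≤ (L + (2 * k + 1) * (L : ℝ)) * L ^ 2 := by gcongr
        _ = (2 * k + 2) * (L : ℝ) ^ 3 := by ring
        _ ≤ n := hn'

/-- `clog 2 n ≤ 3 log n` once `log n ≥ 1`, so the left side is at most `(27K)^4 (log n)^12`, which
is `o(n)`. -/
theorem eventually_clog_pow_le (K : ℕ) :
    ∀ᶠ n : ℕ in atTop, (K * Nat.clog 2 n ^ 3) ^ 4 ≤ n := by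
  have h := (Real.isLittleO_pow_log_id_atTop (n := 12)).bound
    (c := (((K : ℝ) * 27) ^ 4 + 1)⁻¹) (by positivity)
  have h' := (tendsto_natCast_atTop_atTop (R := ℝ)).eventually h
  filter_upwards [h', eventually_ge_atTop 3] with n hn h3
  have hlog : 1 ≤ Real.log n := by
    rw [Real.le_log_iff_exp_le (by positivity)]
    have h3' : (3 : ℝ) ≤ n := by exact_mod_cast h3
    linarith [Real.exp_one_lt_d9]
  have hclog : (Nat.clog 2 n : ℝ) ≤ 3 * Real.log n := by
    have h1 : 2 ^ (Nat.clog 2 n - 1) ≤ n := (Nat.pow_pred_clog_lt_self (by norm_num) (by omega)).le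
    have h2 : ((Nat.clog 2 n - 1 : ℕ) : ℝ) * Real.log 2 ≤ Real.log n := by
      rw [← Real.log_pow]
      exact Real.log_le_log (by positivity) (by exact_mod_cast h1)
    have h4 : (Nat.clog 2 n : ℝ) ≤ ((Nat.clog 2 n - 1 : ℕ) : ℝ) + 1 := by
      exact_mod_cast (by omega : Nat.clog 2 n ≤ Nat.clog 2 n - 1 + 1)
    have h5 : (0 : ℝ) ≤ ((Nat.clog 2 n - 1 : ℕ) : ℝ) := Nat.cast_nonneg _
    nlinarith [Real.log_two_gt_d9]
  have hn2 : Real.log n ^ 12 * (((K : ℝ) * 27) ^ 4 + 1) ≤ n := by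
    rw [Real.norm_eq_abs, abs_of_nonneg (by positivity), id, Real.norm_eq_abs, Nat.abs_cast,
      inv_mul_eq_div, le_div_iff₀ (by positivity)] at hn
    exact hn
  have : ((K : ℝ) * (Nat.clog 2 n : ℝ) ^ 3) ^ 4 ≤ n := by
    calc ((K : ℝ) * (Nat.clog 2 n : ℝ) ^ 3) ^ 4 ≤ (K * (3 * Real.log n) ^ 3) ^ 4 := by gcongr
      _ = Real.log n ^ 12 * ((K : ℝ) * 27) ^ 4 := by ring
      _ ≤ Real.log n ^ 12 * (((K : ℝ) * 27) ^ 4 + 1) := by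
        gcongr
        linarith
      _ ≤ n := hn2
  exact_mod_cast this

theorem spectralNorm_kikuchiMatrix_zero {n r : ℕ} (hr : 2 < r) (G : SymTensor n r) :
    spectralNorm (kikuchiMatrix 0 G) = 0 := by
  have h : kikuchiMatrix 0 G = 0 := by
    ext S T
    have hS := Finset.card_eq_zero.1 S.2
    have hT := Finset.card_eq_zero.1 T.2
    rw [kikuchiMatrix, Matrix.of_apply, if_neg, Matrix.zero_apply]
    rw [hS, hT, symmDiff_self]
    simp
    omega
  rw [h, spectralNorm, map_zero, norm_zero]

theorem measure_spectralNorm_kikuchiMatrix_le_of_large {n k ℓ : ℕ} (hk : 1 ≤ k) (hn3 : 3 ≤ n)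
    (hn : (((2 * k + 2) * 512) * Nat.clog 2 n ^ 3) ^ 4 ≤ n) (hℓn : ℓ ^ 4 ≤ n) :
    1 - (1 : ℝ) / n ≤ (gaussianTensor n (2 * k + 1)).real
      {G | spectralNorm (kikuchiMatrix ℓ G) ≤
        2 * (stepConst k * √((n : ℝ) * ℓ) ^ (2 * k + 1))} := by
  have : IsProbabilityMeasure (gaussianTensor n (2 * k + 1)) := by
    unfold gaussianTensor; infer_instance
  rcases Nat.eq_zero_or_pos ℓ with rfl | hℓ
  · have huniv : {G : SymTensor n (2 * k + 1) | spectralNorm (kikuchiMatrix 0 G) ≤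
        2 * (stepConst k * √((n : ℝ) * (0 : ℕ)) ^ (2 * k + 1))} = Set.univ := by
      ext G
      simp [spectralNorm_kikuchiMatrix_zero (by omega : 2 < 2 * k + 1) G]
    rw [huniv, probReal_univ]
    simp
  set b := Nat.clog 2 n with hb
  have hb1 : 1 ≤ b := Nat.clog_pos (by norm_num) (by omega)
  have hnb : n ≤ 2 ^ b := Nat.le_pow_clog (by norm_num) n
  -- `2 ^ m` is `ℓ log₂ n` up to rounding, so that `C(n,ℓ) ≤ n^ℓ ≤ 2 ^ 2 ^ m`.
  set m := Nat.clog 2 (ℓ * b) with hm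
  have hm1 : ℓ * b ≤ 2 ^ m := Nat.le_pow_clog (by norm_num) _
  have hm2 : 2 ^ m ≤ 2 * (ℓ * b) := by
    rcases Nat.lt_or_ge 1 (ℓ * b) with h | h
    · have h1 := (Nat.pow_pred_clog_lt_self (b := 2) (by norm_num) h).le
      have h2 : 0 < m := Nat.clog_pos (by norm_num) h
      have h3 : 2 ^ m = 2 * 2 ^ (m - 1) := by
        rw [← pow_succ', Nat.sub_add_cancel h2]
      rw [Nat.pred_eq_sub_one, ← hm] at h1
      omega
    · have : m = 0 := Nat.clog_of_right_le_one h 2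
      have hpos : 0 < ℓ * b := Nat.mul_pos hℓ hb1
      rw [this, pow_zero]
      omega
  have hℓm : ℓ ≤ 4 * 2 ^ m := by nlinarith
  have hL : (2 * k + 2) * (4 * 2 ^ m) ^ 3 ≤ n := by
    have h1 : (2 * k + 2) * (4 * 2 ^ m) ^ 3 ≤ ℓ ^ 3 * ((2 * k + 2) * 512 * b ^ 3) := by
      calc (2 * k + 2) * (4 * 2 ^ m) ^ 3 ≤ (2 * k + 2) * (4 * (2 * (ℓ * b))) ^ 3 := by gcongr
        _ = _ := by ring
    -- In fourth powers: `ℓ³` contributes at most `n³` and the logarithmic factor at most `n`.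
    refine h1.trans (le_of_pow_le_pow_left₀ (n := 4) (by norm_num) (Nat.zero_le _) ?_)
    calc (ℓ ^ 3 * ((2 * k + 2) * 512 * b ^ 3)) ^ 4
        = (ℓ ^ 4) ^ 3 * ((2 * k + 2) * 512 * b ^ 3) ^ 4 := by ring
      _ ≤ n ^ 3 * n := by gcongr
      _ = n ^ 4 := by ring
  refine le_trans ?_ (measure_spectralNorm_kikuchiMatrix_le hk hℓ hℓm hL)
  have hchoose : n.choose ℓ ≤ 2 ^ 2 ^ m :=
    calc n.choose ℓ ≤ n ^ ℓ := Nat.choose_le_pow n ℓ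
      _ ≤ (2 ^ b) ^ ℓ := by gcongr
      _ = 2 ^ (ℓ * b) := by rw [← pow_mul, mul_comm]
      _ ≤ 2 ^ 2 ^ m := Nat.pow_le_pow_right (by norm_num) hm1
  have hn2 : n ≤ 2 ^ 2 ^ m := hnb.trans
    (Nat.pow_le_pow_right (by norm_num) ((Nat.le_mul_of_pos_left b hℓ).trans hm1))
  -- Of the two factors `2 ^ 2 ^ m` in the denominator, one absorbs `C(n,ℓ)` and the other is at
  -- least `n`.
  have hkey : (n.choose ℓ : ℝ) / 2 ^ (2 * 2 ^ m) ≤ 1 / n := by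
    rw [div_le_div_iff₀ (by positivity) (by positivity), one_mul, mul_comm 2, pow_mul, pow_two]
    exact_mod_cast Nat.mul_le_mul hchoose hn2
  linarith

end Kikuchi

theorem mainTheorem2 (r : ℕ) (hodd : Odd r) (hr : 2 < r) :
    ∃ δ : ℝ, 0 < δ ∧ ∃ C : ℝ, 0 < C ∧ ∃ ε : ℕ → ℝ, Tendsto ε atTop (𝓝 0) ∧
      ∀ n ℓ : ℕ, (ℓ : ℝ) ≤ (n : ℝ) ^ δ →
        1 - ε n ≤ (Kikuchi.gaussianTensor n r).real
          {G | Kikuchi.spectralNorm (Kikuchi.kikuchiMatrix ℓ G) ≤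
            C * (Real.sqrt ((n : ℝ) * (ℓ : ℝ))) ^ r} := by
  obtain ⟨k, rfl⟩ := hodd
  obtain ⟨N, hN⟩ := eventually_atTop.1
    ((Kikuchi.eventually_clog_pow_le ((2 * k + 2) * 512)).and (eventually_ge_atTop 3))
  -- The exponent `1/4` leaves room `n^(1/4)` for logarithms in `ℓ³ (log n)³ ≲ n`. For the finitely
  -- many `n < N`, `ε = 1` makes the claim trivial.
  refine ⟨1 / 4, by norm_num, 2 * Kikuchi.stepConst k,
    mul_pos two_pos (Kikuchi.stepConst_pos k), fun n => if N ≤ n then 1 / n else 1, ?_, ?_⟩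
  · refine (tendsto_one_div_atTop_nhds_zero_nat (𝕜 := ℝ)).congr' ?_
    filter_upwards [eventually_ge_atTop N] with n hn
    rw [if_pos hn]
  · intro n ℓ hℓ
    by_cases hn : N ≤ n
    · have hℓn : ℓ ^ 4 ≤ n := by
        have h := pow_le_pow_left₀ (Nat.cast_nonneg ℓ) hℓ 4
        rw [← Real.rpow_natCast ((n : ℝ) ^ (1 / 4 : ℝ)), ← Real.rpow_mul (Nat.cast_nonneg n)] at h
        norm_num at h
        exact_mod_cast h
      have h := Kikuchi.measure_spectralNorm_kikuchiMatrix_le_of_large (by omega : 1 ≤ k)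
        (hN n hn).2 (hN n hn).1 hℓn
      simp only [if_pos hn, mul_assoc]
      exact h
    · simp only [if_neg hn, sub_self]
      exact measureReal_nonneg
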